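/- Let $k,d\ge 0$ be integers, $n=k+d$, let $\Theta$ be an antisymmetric real $n\times n$ matrix, and put $\sigma_\Theta(x,y)=e^{-\pi i\langle x,\Theta y\rangle}$ for $x,y\in\mathbb Z^n$. Let $\mathcal T_r(\mathbb N^n,\sigma_\Theta)$ be the Toeplitz noncommutative torus, i.e. the C*-subalgebra of $\mathcal B(\ell^2(\mathbb N^n))$ generated by the isometries $L_p\delta_q=\sigma_\Theta(p,q)\delta_{p+q}$ ($p,q\in\mathbb N^n$), and let $\mathcal A_\Theta$ be the noncommutative torus, realised as the C*-subalgebra of $\mathcal B(\ell^2(\mathbb Z^n))$ generated by the unitaries $\lambda_x\delta_y=\sigma_\Theta(x,y)\delta_{x+y}$ ($x,y\in\mathbb Z^n$), with canonical generators $U_j=\lambda_{e_j}$. On both algebras the gauge action $\gamma$ of $\mathbb T^n$ is given by $\gamma_z=\mathrm{Ad}(D_z)$, where $D_z\delta_q=z^q\delta_q$. Fix $r=(r_1,\dots,r_k,0,\dots,0)\in\mathbb R^n$ with $r_j>0$ for $1\le j\le k$, and let $\alpha_t=\gamma_{(e^{ir_1t},\dots,e^{ir_nt})}$ for $t\in\mathbb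 R$. A $\mathrm{KMS}_\beta$ state of $(\mathcal T_r(\mathbb N^n,\sigma_\Theta),\alpha)$ is a state $\varphi$ with $\varphi(AB)=\varphi(B\alpha_{i\beta}(A))$ for all $\alpha$-analytic $A$ and all $B$; a $\mathrm{KMS}_0$ state is an $\alpha$-invariant tracial state; and a $\mathrm{KMS}_{0^+}$ state is a weak* limit of $\mathrm{KMS}_\beta$ states as $\beta\to0^+$. Let $$H_n^r=\{w\in\mathbb Z^n:\langle w,\Theta v\rangle\in\mathbb Z\ \text{for all } v\in\mathbb Z^n\}\cap\{w\in\mathbb Z^n:\langle w,r\rangle=0\},$$ $$\Lambda_n^r=\{z\in\mathbb T^n: z^h=1\ \text{for all } h\in H_n^r\},$$ and let $\mathcal A_\Theta^{\Lambda_n^r}$ be the fixed point algebra of the restriction of the gauge action of $\mathcal A_\Theta$ to $\Lambda_n^r$. Let $E^{\Lambda_n^r}\colon\mathcal A_\Theta\to\mathcal A_\Theta^{\Lambda_n^r}$, $E^{\Lambda_n^r}(a)=\int_{\Lambda_n^r}\gamma_z(a)\,dz$, be the conditional expectation given by averaging with respect to normalised Haar measure. Then: 1. $\mathcal A_\Theta^{\Lambda_n^r}=\{a\in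 \mathrm Z(\mathcal A_\Theta):\alpha_t(a)=a\ \text{for all } t\in\mathbb R\}$, the $\alpha$-fixed part of the center. 2. There is a (unique) unital $*$-homomorphism $\pi\colon\mathcal T_r(\mathbb N^n,\sigma_\Theta)\to\mathcal A_\Theta$ with $\pi(L_{e_j})=U_j$ for $1\le j\le n$, and the map $\omega\mapsto\omega\circ E^{\Lambda_n^r}\circ\pi$ is an affine weak* homeomorphism of the state space of $\mathcal A_\Theta^{\Lambda_n^r}$ onto the space of $\mathrm{KMS}_0$ states of $(\mathcal T_r(\mathbb N^n,\sigma_\Theta),\alpha)$. 3. If $H_n^r\cap(\mathbb Z^k\times 0_d)\neq\{0\}$, then the space of $\mathrm{KMS}_{0^+}$ states of $(\mathcal T_r(\mathbb N^n,\sigma_\Theta),\alpha)$ is properly contained in the space of $\mathrm{KMS}_0$ states. -/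

import Mathlib

open Set Filter Topology MeasureTheory
open scoped Matrix ComplexOrder ENNReal

noncomputable section

namespace ToeplitzTori

/-! ### The cocycle and the twisted left regular representations -/

/-- The pairing `⟨x, Θ y⟩` for `x, y ∈ ℤⁿ`. -/
def pairing {n : ℕ} (Θ : Matrix (Fin n) (Fin n) ℝ) (x y : Fin n → ℤ) : ℝ :=
  (fun j => (x j : ℝ)) ⬝ᵥ (Θ *ᵥ (fun j => (y j : ℝ)))

/-- The cocycle `σ_Θ(x, y) = exp(-π i ⟨x, Θ y⟩)`. -/
def cocycle {n : ℕ} (Θ : Matrix (Fin n) (Fin n) ℝ) (x y : Fin n → ℤ) : Circle :=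
  Circle.exp (-(Real.pi * pairing Θ x y))

/-- The semigroup `ℕⁿ`, viewed inside `ℤⁿ`. -/
def natCone (n : ℕ) : AddSubmonoid (Fin n → ℤ) where
  carrier := {p | ∀ j, 0 ≤ p j}
  zero_mem' := fun _ => le_rfl
  add_mem' := fun ha hb j => add_nonneg (ha j) (hb j)

/-- The standard basis vector `e_j`, an element of `ℕⁿ`. -/
def stdVec {n : ℕ} (j : Fin n) : natCone n :=
  ⟨Pi.single j 1, fun i => by
    by_cases h : i = j
    · subst h; simp
    · simp [Pi.single_eq_of_ne h]⟩

/-- The Hilbert space `ℓ²(P)`. -/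
abbrev Ell2 {n : ℕ} (P : AddSubmonoid (Fin n → ℤ)) : Type :=
  lp (fun _ : P => ℂ) 2

open Classical in
/-- The canonical orthonormal basis vector `δ_q` of `ℓ²(P)`. -/
def delta {n : ℕ} (P : AddSubmonoid (Fin n → ℤ)) (q : P) : Ell2 P :=
  lp.single 2 q (1 : ℂ)

theorem orthonormal_monomial {n : ℕ} (P : AddSubmonoid (Fin n → ℤ)) (f : P → P)
    (hf : Function.Injective f) (c : P → Circle) :
    Orthonormal ℂ (fun q => (c q : ℂ) • delta P (f q)) := by
  classical
  rw [orthonormal_iff_ite]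
  intro i j
  rw [inner_smul_left, inner_smul_right, delta, delta, lp.inner_single_left]
  by_cases h : i = j
  · subst h
    simp [← Circle.coe_inv_eq_conj]
  · have h' : f i ≠ f j := fun e => h (hf e)
    simp [h, h', lp.single_apply]

/-- The isometry of `ℓ²(P)` with `δ_q ↦ c(q) δ_{f(q)}`, for `f` injective and `c` circle valued. -/
def monomialOp {n : ℕ} (P : AddSubmonoid (Fin n → ℤ)) (f : P → P)
    (hf : Function.Injective f) (c : P → Circle) : Ell2 P →L[ℂ] Ell2 P :=
  (orthonormal_monomial P f hf c).orthogonalFamily.linearIsometry.toContinuousLinearMap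

theorem monomialOp_delta {n : ℕ} (P : AddSubmonoid (Fin n → ℤ)) (f : P → P)
    (hf : Function.Injective f) (c : P → Circle) (q : P) :
    monomialOp P f hf c (delta P q) = (c q : ℂ) • delta P (f q) := by
  classical
  simp [monomialOp, delta]

/-- Bounded operators on `ℓ²(P)` that agree on all `δ_q` are equal. -/
theorem ext_delta {n : ℕ} (P : AddSubmonoid (Fin n → ℤ)) {S T : Ell2 P →L[ℂ] Ell2 P}
    (h : ∀ q, S (delta P q) = T (delta P q)) : S = T := by
  classical
  apply lp.ext_continuousLinearMap (by norm_num)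
  intro i
  ext1
  simpa [delta] using h i

/-- The left regular `σ_Θ`-representation of `P`: `δ_q ↦ σ_Θ(p, q) δ_{p+q}`. -/
def leftReg {n : ℕ} (Θ : Matrix (Fin n) (Fin n) ℝ) (P : AddSubmonoid (Fin n → ℤ)) (p : P) :
    Ell2 P →L[ℂ] Ell2 P :=
  monomialOp P (fun q => p + q) (add_right_injective p) (fun q => cocycle Θ p q)

/-- The reduced twisted semigroup C*-algebra of `P`, the C*-subalgebra of `B(ℓ²(P))` generated by
the operators `leftReg Θ P p`. -/
def redAlg {n : ℕ} (Θ : Matrix (Fin n) (Fin n) ℝ) (P : AddSubmonoid (Fin n → ℤ)) :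
    StarSubalgebra ℂ (Ell2 P →L[ℂ] Ell2 P) :=
  (StarAlgebra.adjoin ℂ (range (leftReg Θ P))).topologicalClosure

instance {n : ℕ} (Θ : Matrix (Fin n) (Fin n) ℝ) (P : AddSubmonoid (Fin n → ℤ)) :
    CompleteSpace (redAlg Θ P) :=
  inferInstanceAs (CompleteSpace (StarSubalgebra.topologicalClosure _))

/-- `leftReg Θ P p` as an element of `redAlg Θ P`. -/
def gen {n : ℕ} (Θ : Matrix (Fin n) (Fin n) ℝ) (P : AddSubmonoid (Fin n → ℤ)) (p : P) :
    redAlg Θ P :=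
  ⟨leftReg Θ P p, StarSubalgebra.le_topologicalClosure _
    (StarAlgebra.subset_adjoin ℂ _ (mem_range_self p))⟩

/-- The Toeplitz noncommutative torus `𝒯_r(ℕⁿ, σ_Θ)`. -/
abbrev ToeplitzTorus {n : ℕ} (Θ : Matrix (Fin n) (Fin n) ℝ) : Type :=
  redAlg Θ (natCone n)

/-- The noncommutative torus `𝒜_Θ`, realised on `ℓ²(ℤⁿ)` as the C*-algebra generated by the left
regular unitary `σ_Θ`-representation of `ℤⁿ`. -/
abbrev NCTorus {n : ℕ} (Θ : Matrix (Fin n) (Fin n) ℝ) : Type :=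
  redAlg Θ (⊤ : AddSubmonoid (Fin n → ℤ))

/-- The isometries `L_p` in the Toeplitz noncommutative torus. -/
def isom {n : ℕ} (Θ : Matrix (Fin n) (Fin n) ℝ) (p : natCone n) : ToeplitzTorus Θ :=
  gen Θ (natCone n) p

/-- The canonical unitary generators `U_j` of the noncommutative torus. -/
def unitaryGen {n : ℕ} (Θ : Matrix (Fin n) (Fin n) ℝ) (j : Fin n) : NCTorus Θ :=
  gen Θ ⊤ ⟨Pi.single j 1, trivial⟩

/-! ### The gauge action and the dynamics -/

/-- `z^x = ∏ⱼ zⱼ^{xⱼ}`. -/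
def monomial {n : ℕ} (z : Fin n → Circle) (x : Fin n → ℤ) : Circle :=
  ∏ j, z j ^ x j

theorem monomial_mul {n : ℕ} (z w : Fin n → Circle) (x : Fin n → ℤ) :
    monomial (z * w) x = monomial z x * monomial w x := by
  simp [monomial, mul_zpow, Finset.prod_mul_distrib]

theorem monomial_one {n : ℕ} (x : Fin n → ℤ) : monomial (1 : Fin n → Circle) x = 1 := by
  simp [monomial]

theorem monomial_add {n : ℕ} (z : Fin n → Circle) (x y : Fin n → ℤ) :
    monomial z (x + y) = monomial z x * monomial z y := by
  simp [monomial, zpow_add, Finset.prod_mul_distrib]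

/-- The diagonal operator `δ_q ↦ z^q δ_q`. -/
def diagOp {n : ℕ} (P : AddSubmonoid (Fin n → ℤ)) (z : Fin n → Circle) : Ell2 P →L[ℂ] Ell2 P :=
  monomialOp P id Function.injective_id (fun q => monomial z q)

theorem diagOp_mul {n : ℕ} (P : AddSubmonoid (Fin n → ℤ)) (z w : Fin n → Circle) :
    diagOp P (z * w) = diagOp P z * diagOp P w := by
  apply ext_delta
  intro q
  simp [diagOp, monomialOp_delta, monomial_mul, smul_smul, mul_comm]

theorem diagOp_one {n : ℕ} (P : AddSubmonoid (Fin n → ℤ)) : diagOp P 1 = 1 := by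
  apply ext_delta
  intro q
  simp [diagOp, monomialOp_delta, monomial_one]

theorem star_diagOp_mul_self {n : ℕ} (P : AddSubmonoid (Fin n → ℤ)) (z : Fin n → Circle) :
    star (diagOp P z) * diagOp P z = 1 := by
  rw [ContinuousLinearMap.star_eq_adjoint]
  exact (ContinuousLinearMap.norm_map_iff_adjoint_comp_self _).1 fun x =>
    (orthonormal_monomial P id Function.injective_id _).orthogonalFamily.linearIsometry.norm_map x

theorem star_diagOp {n : ℕ} (P : AddSubmonoid (Fin n → ℤ)) (z : Fin n → Circle) :
    star (diagOp P z) = diagOp P z⁻¹ := by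
  have h : diagOp P z * diagOp P z⁻¹ = 1 := by
    rw [← diagOp_mul, mul_inv_cancel, diagOp_one]
  exact left_inv_eq_right_inv (star_diagOp_mul_self P z) h

/-- The unitary `δ_q ↦ z^q δ_q`. -/
def diagUnitary {n : ℕ} (P : AddSubmonoid (Fin n → ℤ)) (z : Fin n → Circle) :
    unitary (Ell2 P →L[ℂ] Ell2 P) :=
  ⟨diagOp P z, by
    rw [Unitary.mem_iff, star_diagOp, ← diagOp_mul, ← diagOp_mul]
    simp [diagOp_one]⟩

theorem diag_conj_leftReg {n : ℕ} (Θ : Matrix (Fin n) (Fin n) ℝ) (P : AddSubmonoid (Fin n → ℤ))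
    (z : Fin n → Circle) (p : P) :
    diagOp P z * leftReg Θ P p * diagOp P z⁻¹ = (monomial z p : ℂ) • leftReg Θ P p := by
  have h : diagOp P z * leftReg Θ P p = (monomial z p : ℂ) • (leftReg Θ P p * diagOp P z) := by
    apply ext_delta
    intro q
    simp [diagOp, leftReg, monomialOp_delta, monomial_add, smul_smul]
    ring_nf
  rw [h, smul_mul_assoc, mul_assoc, ← diagOp_mul, mul_inv_cancel, diagOp_one, mul_one]

theorem diag_conj_mem {n : ℕ} (Θ : Matrix (Fin n) (Fin n) ℝ) (P : AddSubmonoid (Fin n → ℤ))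
    (z : Fin n → Circle) {a : Ell2 P →L[ℂ] Ell2 P} (ha : a ∈ redAlg Θ P) :
    diagOp P z * a * diagOp P z⁻¹ ∈ redAlg Θ P := by
  let φ : (Ell2 P →L[ℂ] Ell2 P) →⋆ₐ[ℂ] (Ell2 P →L[ℂ] Ell2 P) :=
    (Unitary.conjStarAlgAut ℂ (Ell2 P →L[ℂ] Ell2 P) (diagUnitary P z) :
      (Ell2 P →L[ℂ] Ell2 P) →⋆ₐ[ℂ] (Ell2 P →L[ℂ] Ell2 P))
  have hφ : ∀ b, φ b = diagOp P z * b * diagOp P z⁻¹ := fun b => by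
    rw [← star_diagOp]; rfl
  have hc : Continuous φ := by
    have : (φ : (Ell2 P →L[ℂ] Ell2 P) → _) = fun b => diagOp P z * b * diagOp P z⁻¹ := funext hφ
    rw [this]
    fun_prop
  have hle : redAlg Θ P ≤ (redAlg Θ P).comap φ := by
    apply StarSubalgebra.topologicalClosure_minimal
    · rw [StarAlgebra.adjoin_le_iff]
      rintro _ ⟨p, rfl⟩
      change φ (leftReg Θ P p) ∈ redAlg Θ P
      rw [hφ, diag_conj_leftReg]
      exact SMulMemClass.smul_mem _ (gen Θ P p).2
    · exact (StarSubalgebra.isClosed_topologicalClosure _).preimage hc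
  have := hle ha
  rw [StarSubalgebra.mem_comap, hφ] at this
  exact this

/-- The gauge automorphism `γ_z = Ad(diagOp z)` of the reduced twisted algebra. -/
def gauge {n : ℕ} (Θ : Matrix (Fin n) (Fin n) ℝ) (P : AddSubmonoid (Fin n → ℤ))
    (z : Fin n → Circle) : redAlg Θ P ≃⋆ₐ[ℂ] redAlg Θ P where
  toFun a := ⟨diagOp P z * a * diagOp P z⁻¹, diag_conj_mem Θ P z a.2⟩
  invFun a := ⟨diagOp P z⁻¹ * a * diagOp P z, by
    simpa using diag_conj_mem Θ P z⁻¹ a.2⟩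
  left_inv a := by
    have h : diagOp P z⁻¹ * diagOp P z = 1 := by rw [← diagOp_mul]; simp [diagOp_one]
    ext1
    simp only [← mul_assoc, h, one_mul]
    simp only [mul_assoc, h, mul_one]
  right_inv a := by
    have h : diagOp P z * diagOp P z⁻¹ = 1 := by rw [← diagOp_mul]; simp [diagOp_one]
    ext1
    simp only [← mul_assoc, h, one_mul]
    simp only [mul_assoc, h, mul_one]
  map_mul' a b := by
    have h : diagOp P z⁻¹ * diagOp P z = 1 := by rw [← diagOp_mul]; simp [diagOp_one]
    ext1
    simp only [MulMemClass.coe_mul, mul_assoc]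
    rw [← mul_assoc (diagOp P z⁻¹) (diagOp P z), h, one_mul]
  map_add' a b := by
    ext1
    simp [mul_add, add_mul]
  map_star' a := by
    ext1
    simp [star_mul, star_diagOp, mul_assoc]
  map_smul' c a := by
    ext1
    simp

theorem gauge_mul_apply {n : ℕ} (Θ : Matrix (Fin n) (Fin n) ℝ) (P : AddSubmonoid (Fin n → ℤ))
    (z w : Fin n → Circle) (a : redAlg Θ P) :
    gauge Θ P (z * w) a = gauge Θ P z (gauge Θ P w a) := by
  ext1
  change diagOp P (z * w) * a * diagOp P (z * w)⁻¹ =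
    diagOp P z * (diagOp P w * a * diagOp P w⁻¹) * diagOp P z⁻¹
  rw [mul_inv_rev, diagOp_mul, diagOp_mul]
  simp only [mul_assoc]

/-- The one-parameter automorphism group `α^r_t = γ_{(e^{i r₁ t}, …, e^{i rₙ t})}`. -/
def dynamics {n : ℕ} (Θ : Matrix (Fin n) (Fin n) ℝ) (P : AddSubmonoid (Fin n → ℤ))
    (r : Fin n → ℝ) (t : ℝ) : redAlg Θ P ≃⋆ₐ[ℂ] redAlg Θ P :=
  gauge Θ P (fun j => Circle.exp (r j * t))

/-! ### The group `H_n^r`, its annihilator, and the conditional expectation -/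

/-- `H_n^r = {w ∈ ℤⁿ | ⟨w, Θ v⟩ ∈ ℤ for all v ∈ ℤⁿ} ∩ {w ∈ ℤⁿ | ⟨w, r⟩ = 0}`. -/
def degGroup {n : ℕ} (Θ : Matrix (Fin n) (Fin n) ℝ) (r : Fin n → ℝ) : Set (Fin n → ℤ) :=
  {w | ∀ v : Fin n → ℤ, ∃ m : ℤ, pairing Θ w v = m} ∩ {w | ∑ j, (w j : ℝ) * r j = 0}

/-- `Λ_n^r = {z ∈ 𝕋ⁿ | z^h = 1 for all h ∈ H_n^r}`. -/
def annihilator {n : ℕ} (Θ : Matrix (Fin n) (Fin n) ℝ) (r : Fin n → ℝ) :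
    Subgroup (Fin n → Circle) where
  carrier := {z | ∀ h ∈ degGroup Θ r, monomial z h = 1}
  one_mem' := fun h _ => monomial_one h
  mul_mem' := fun ha hb h hh => by rw [monomial_mul, ha h hh, hb h hh, mul_one]
  inv_mem' := fun {z} hz h hh => by
    have := monomial_mul z z⁻¹ h
    rw [mul_inv_cancel, monomial_one, hz h hh, one_mul] at this
    exact this.symm

instance {n : ℕ} (Θ : Matrix (Fin n) (Fin n) ℝ) (r : Fin n → ℝ) :
    CompactSpace (annihilator Θ r) := by
  have : IsClosed (annihilator Θ r : Set (Fin n → Circle)) := by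
    have h : (annihilator Θ r : Set (Fin n → Circle)) =
        ⋂ h ∈ degGroup Θ r, {z | monomial z h = 1} := by
      ext z; simp [annihilator]
    rw [h]
    refine isClosed_biInter fun h _ => isClosed_eq ?_ continuous_const
    unfold monomial
    fun_prop
  exact isCompact_iff_compactSpace.1 this.isCompact

/-- The normalised Haar measure on the compact group `Λ_n^r`. -/
def haarProb {n : ℕ} (Θ : Matrix (Fin n) (Fin n) ℝ) (r : Fin n → ℝ) :
    @Measure (annihilator Θ r) (borel _) :=
  letI : MeasurableSpace (annihilator Θ r) := borel _
  haveI : BorelSpace (annihilator Θ r) := ⟨rfl⟩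
  Measure.haarMeasure ⊤

/-- The fixed point algebra of the restriction to `Λ_n^r` of the gauge action on `𝒜_Θ`. -/
def fixedAlg {n : ℕ} (Θ : Matrix (Fin n) (Fin n) ℝ) (r : Fin n → ℝ) :
    StarSubalgebra ℂ (NCTorus Θ) where
  carrier := {a | ∀ z ∈ annihilator Θ r, gauge Θ ⊤ z a = a}
  mul_mem' := fun ha hb z hz => by rw [map_mul, ha z hz, hb z hz]
  add_mem' := fun ha hb z hz => by rw [map_add, ha z hz, hb z hz]
  algebraMap_mem' := fun c z _ => AlgHomClass.commutes (gauge Θ ⊤ z) c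
  star_mem' := fun {a} ha z hz => by
    have h := (gauge Θ ⊤ z).map_star' a
    exact h.trans (congrArg star (ha z hz))

/-- The average `∫_{Λ_n^r} γ_z(a) dz`. -/
def gaugeAverage {n : ℕ} (Θ : Matrix (Fin n) (Fin n) ℝ) (r : Fin n → ℝ) (a : NCTorus Θ) :
    NCTorus Θ :=
  letI : MeasurableSpace (annihilator Θ r) := borel _
  ∫ z : annihilator Θ r, gauge Θ ⊤ z a ∂(haarProb Θ r)

theorem norm_gauge {n : ℕ} (Θ : Matrix (Fin n) (Fin n) ℝ) (P : AddSubmonoid (Fin n → ℤ))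
    (z : Fin n → Circle) (a : redAlg Θ P) : ‖gauge Θ P z a‖ = ‖a‖ := by
  change ‖diagOp P z * (a : Ell2 P →L[ℂ] Ell2 P) * diagOp P z⁻¹‖ = ‖(a : Ell2 P →L[ℂ] Ell2 P)‖
  have h1 := CStarRing.norm_coe_unitary_mul (diagUnitary P z) (a : Ell2 P →L[ℂ] Ell2 P)
  have h2 := CStarRing.norm_mul_coe_unitary
    (diagOp P z * (a : Ell2 P →L[ℂ] Ell2 P)) (diagUnitary P z⁻¹)
  exact h2.trans h1

theorem gaugeAverage_mem {n : ℕ} (Θ : Matrix (Fin n) (Fin n) ℝ) (r : Fin n → ℝ) (a : NCTorus Θ) :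
    gaugeAverage Θ r a ∈ fixedAlg Θ r := by
  intro w hw
  letI : MeasurableSpace (annihilator Θ r) := borel _
  haveI : BorelSpace (annihilator Θ r) := ⟨rfl⟩
  let φ : NCTorus Θ →ₗᵢ[ℂ] NCTorus Θ :=
    { toFun := gauge Θ ⊤ w
      map_add' := (gauge Θ ⊤ w).map_add'
      map_smul' := (gauge Θ ⊤ w).map_smul'
      norm_map' := norm_gauge Θ ⊤ w }
  change φ (∫ z : annihilator Θ r, gauge Θ ⊤ z a ∂(haarProb Θ r)) = _
  rw [← LinearIsometry.integral_comp_comm]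
  have h : ∀ z : annihilator Θ r, φ (gauge Θ ⊤ z a) =
      gauge Θ ⊤ ((⟨w, hw⟩ * z : annihilator Θ r) : Fin n → Circle) a :=
    fun z => (gauge_mul_apply Θ ⊤ w z a).symm
  simp_rw [h]
  exact integral_mul_left_eq_self (μ := Measure.haarMeasure ⊤)
    (fun z : annihilator Θ r => gauge Θ ⊤ z a) ⟨w, hw⟩

/-- The conditional expectation `E^{Λ_n^r}` of `𝒜_Θ` onto the fixed point algebra of `Λ_n^r`,
obtained by averaging the gauge action over `Λ_n^r`. -/
def condExpAnn {n : ℕ} (Θ : Matrix (Fin n) (Fin n) ℝ) (r : Fin n → ℝ) (a : NCTorus Θ) :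
    fixedAlg Θ r :=
  ⟨gaugeAverage Θ r a, gaugeAverage_mem Θ r a⟩

/-! ### States, traces, KMS states -/

/-- The state space of a unital C*-algebra, inside its dual with the weak* topology. -/
def stateSpace (A : Type*) [NormedRing A] [StarRing A] [NormedAlgebra ℂ A] :
    Set (WeakDual ℂ A) :=
  {φ | φ 1 = 1 ∧ ∀ a : A, 0 ≤ φ (star a * a)}

/-- The `KMS_β` states of `(𝒯_r(ℕⁿ, σ_Θ), α^r)`: the states `φ` with `φ(AB) = φ(B α_{iβ}(A))` for
every `B` and every analytic `A`, where `A` is analytic when `t ↦ α_t(A)` extends to an entire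
function `F`, whose value at `iβ` is `α_{iβ}(A)`. -/
def kmsStates {n : ℕ} (Θ : Matrix (Fin n) (Fin n) ℝ) (r : Fin n → ℝ) (β : ℝ) :
    Set (WeakDual ℂ (ToeplitzTorus Θ)) :=
  {φ | φ ∈ stateSpace (ToeplitzTorus Θ) ∧
    ∀ (A B : ToeplitzTorus Θ) (F : ℂ → ToeplitzTorus Θ), Differentiable ℂ F →
      (∀ t : ℝ, F t = dynamics Θ (natCone n) r t A) →
      φ (A * B) = φ (B * F (Complex.I * β))}

/-- The `KMS_0` states: the `α^r`-invariant tracial states. -/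
def kmsZeroStates {n : ℕ} (Θ : Matrix (Fin n) (Fin n) ℝ) (r : Fin n → ℝ) :
    Set (WeakDual ℂ (ToeplitzTorus Θ)) :=
  {φ | φ ∈ stateSpace (ToeplitzTorus Θ) ∧
    (∀ A B : ToeplitzTorus Θ, φ (A * B) = φ (B * A)) ∧
    ∀ (t : ℝ) (A : ToeplitzTorus Θ), φ (dynamics Θ (natCone n) r t A) = φ A}

/-- The `KMS_{0⁺}` states: the weak* limits of (nets of) `KMS_β` states as `β → 0⁺`. -/
def kmsZeroPlusStates {n : ℕ} (Θ : Matrix (Fin n) (Fin n) ℝ) (r : Fin n → ℝ) :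
    Set (WeakDual ℂ (ToeplitzTorus Θ)) :=
  {φ | ∃ (ι : Type) (l : Filter ι) (β : ι → ℝ) (ψ : ι → WeakDual ℂ (ToeplitzTorus Θ)),
    l.NeBot ∧ Tendsto β l (𝓝[>] 0) ∧ (∀ i, ψ i ∈ kmsStates Θ r (β i)) ∧ Tendsto ψ l (𝓝 φ)}

/-- A map between sets of functionals is affine if it preserves convex combinations. -/
def IsAffineMap {A B : Type*} [NormedRing A] [NormedAlgebra ℂ A] [NormedRing B]
    [NormedAlgebra ℂ B] {S : Set (WeakDual ℂ A)} {T : Set (WeakDual ℂ B)} (f : S → T) : Prop :=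
  ∀ (φ ψ χ : S) (s : ℝ), 0 ≤ s → s ≤ 1 →
    (χ : WeakDual ℂ A) = (s : ℂ) • (φ : WeakDual ℂ A) + ((1 - s : ℝ) : ℂ) • (ψ : WeakDual ℂ A) →
    (f χ : WeakDual ℂ B) =
      (s : ℂ) • (f φ : WeakDual ℂ B) + ((1 - s : ℝ) : ℂ) • (f ψ : WeakDual ℂ B)

end ToeplitzTori

end

namespace ToeplitzTori

noncomputable section

section

variable {n : ℕ} {Θ : Matrix (Fin n) (Fin n) ℝ} {P : AddSubmonoid (Fin n → ℤ)}

/-! ### The bicharacter -/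

/-! The gauge action grades both algebras by ℤⁿ, and all the automorphisms that matter are gauge
automorphisms: Ad λ_v is `gauge` at `innerChar Θ v` (`lam_conj`), and α_t is `gauge` at `dynChar r
t`. A degree x lies in H_n^r exactly when all these characters are trivial on x (`innerChar_mem`,
`dynChar_mem`, `mem_degGroup_of_monomial`). An element of 𝒜_Θ is determined by its Fourier
coefficients, and γ_z multiplies the x-th one by z^x. Hence "central and α-fixed" and "fixed by
Λ_n^r" both say that the coefficients are supported on H_n^r, which is claim 1.

For claim 2, the quotient map `quot` sends an operator on ℓ²(ℕⁿ) to its limit under translation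
towards infinity in the cone, and compression to ℓ²(ℕⁿ) gives a linear section `toepl`. A positive
trace vanishes on the projections 1 - L_p L_p*, so by Cauchy–Schwarz it does not see the failure of
`toepl` to be multiplicative, and it factors through `quot` (`tracial_toepl_quot`). Traciality and
α-invariance then kill λ_x for x outside H_n^r, so the trace factors through the conditional
expectation. Conversely, for a state ω of the fixed point algebra, ω ∘ E is positive, as one sees by
splitting along cosets of H_n^r (`functional_nonneg`), and it is tracial because it is invariant
under each Ad λ_v.

For claim 3, the KMS condition on a homogeneous element of degree x carries the factor e^{-⟨x,r⟩β},
which tends to 1; so KMS_{0⁺} states are invariant traces. Properness comes from writing w = p - q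
in H_n^r with p, q of disjoint support. Then L_q* L_p is a unimodular multiple of L_p L_q*, and
⟨p,r⟩ > 0 makes every KMS_β state with β > 0 vanish on L_p L_q* (`kmsStates_isom_mul_star_isom`).
This passes to KMS_{0⁺} states, whereas some state of the fixed point algebra does not vanish on
λ_w. -/

theorem pairing_add_left (x y z : Fin n → ℤ) :
    pairing Θ (x + y) z = pairing Θ x z + pairing Θ y z := by
  have : (fun j => ((x + y) j : ℝ)) = (fun j => (x j : ℝ)) + fun j => (y j : ℝ) := by
    ext j; simp
  rw [pairing, this, add_dotProduct]; rfl

theorem pairing_add_right (x y z : Fin n → ℤ) :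
    pairing Θ x (y + z) = pairing Θ x y + pairing Θ x z := by
  have : (fun j => ((y + z) j : ℝ)) = (fun j => (y j : ℝ)) + fun j => (z j : ℝ) := by
    ext j; simp
  rw [pairing, this, Matrix.mulVec_add, dotProduct_add]; rfl

theorem pairing_swap (hΘ : Θᵀ = -Θ) (x y : Fin n → ℤ) : pairing Θ y x = -pairing Θ x y := by
  rw [pairing, pairing, Matrix.dotProduct_mulVec, dotProduct_comm, ← Matrix.mulVec_transpose, hΘ,
    Matrix.neg_mulVec, dotProduct_neg]

theorem pairing_zero_left (x : Fin n → ℤ) : pairing Θ 0 x = 0 := by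
  have := pairing_add_left (Θ := Θ) 0 0 x
  simpa using this

theorem pairing_zero_right (x : Fin n → ℤ) : pairing Θ x 0 = 0 := by
  have := pairing_add_right (Θ := Θ) x 0 0
  simpa using this

theorem pairing_neg_left (x y : Fin n → ℤ) : pairing Θ (-x) y = -pairing Θ x y := by
  have := pairing_add_left (Θ := Θ) x (-x) y
  rw [add_neg_cancel, pairing_zero_left] at this
  linarith

theorem pairing_self (hΘ : Θᵀ = -Θ) (x : Fin n → ℤ) : pairing Θ x x = 0 := by
  have := pairing_swap hΘ x x
  linarith

theorem cocycle_add_left (x y z : Fin n → ℤ) :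
    cocycle Θ (x + y) z = cocycle Θ x z * cocycle Θ y z := by
  simp only [cocycle, pairing_add_left, ← Circle.exp_add]
  congr 1; ring

theorem cocycle_add_right (x y z : Fin n → ℤ) :
    cocycle Θ x (y + z) = cocycle Θ x y * cocycle Θ x z := by
  simp only [cocycle, pairing_add_right, ← Circle.exp_add]
  congr 1; ring

theorem cocycle_zero_left (x : Fin n → ℤ) : cocycle Θ 0 x = 1 := by
  simp [cocycle, pairing_zero_left]

theorem cocycle_zero_right (x : Fin n → ℤ) : cocycle Θ x 0 = 1 := by
  simp [cocycle, pairing_zero_right]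

theorem cocycle_self (hΘ : Θᵀ = -Θ) (x : Fin n → ℤ) : cocycle Θ x x = 1 := by
  simp [cocycle, pairing_self hΘ]

theorem cocycle_neg_left (x y : Fin n → ℤ) : cocycle Θ (-x) y = (cocycle Θ x y)⁻¹ := by
  rw [eq_inv_iff_mul_eq_one, ← cocycle_add_left, neg_add_cancel, cocycle_zero_left]

theorem cocycle_neg_right (x y : Fin n → ℤ) : cocycle Θ x (-y) = (cocycle Θ x y)⁻¹ := by
  rw [eq_inv_iff_mul_eq_one, ← cocycle_add_right, neg_add_cancel, cocycle_zero_right]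

theorem cocycle_swap (hΘ : Θᵀ = -Θ) (x y : Fin n → ℤ) :
    cocycle Θ y x = (cocycle Θ x y)⁻¹ := by
  rw [cocycle, pairing_swap hΘ x y, cocycle, ← Circle.exp_neg]
  congr 1; ring

/-! ### Operators on `ℓ²(P)` -/

theorem inner_delta (q : P) (ξ : Ell2 P) : inner ℂ (delta P q) ξ = ξ q := by
  classical
  rw [delta, lp.inner_single_left]
  simp

theorem delta_apply_self (p : P) : delta P p p = 1 := by
  simp [delta]

theorem delta_apply_of_ne {p q : P} (h : q ≠ p) : delta P p q = 0 := by
  simp [delta, lp.single_apply, h]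

/-- A closed subspace of `ℓ²(P)` containing all `δ_q` is everything. -/
theorem ell2_induction {p : Ell2 P → Prop} (closed : IsClosed {ξ | p ξ}) (zero : p 0)
    (delta : ∀ q, p (delta P q)) (add : ∀ ξ η, p ξ → p η → p (ξ + η))
    (smul : ∀ (c : ℂ) ξ, p ξ → p (c • ξ)) (ξ : Ell2 P) : p ξ := by
  classical
  have h := lp.hasSum_single (p := 2) (by norm_num) ξ
  refine closed.mem_of_tendsto h (Eventually.of_forall fun s => ?_)
  change p _
  induction s using Finset.induction_on with
  | empty => simpa using zero
  | insert i s hi ih =>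
    rw [Finset.sum_insert hi]
    refine add _ _ ?_ ih
    have : lp.single 2 i (ξ i) = (ξ i) • ToeplitzTori.delta P i := by
      rw [ToeplitzTori.delta, ← lp.single_smul]; simp
    rw [this]
    exact smul _ _ (delta i)

theorem leftReg_delta (p q : P) :
    leftReg Θ P p (delta P q) = (cocycle Θ p q : ℂ) • delta P (p + q) :=
  monomialOp_delta P _ _ _ q

theorem leftReg_mul (p q : P) :
    leftReg Θ P p * leftReg Θ P q = (cocycle Θ p q : ℂ) • leftReg Θ P (p + q) := by
  apply ext_delta
  intro s
  simp [leftReg_delta, smul_smul, cocycle_add_left, cocycle_add_right, add_assoc]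
  ring_nf

theorem leftReg_zero : leftReg Θ P 0 = 1 := by
  apply ext_delta
  intro s
  simp [leftReg_delta, cocycle_zero_left]

theorem monomialOp_norm_apply (f : P → P) (hf : Function.Injective f) (c : P → Circle)
    (ξ : Ell2 P) : ‖monomialOp P f hf c ξ‖ = ‖ξ‖ :=
  (orthonormal_monomial P f hf c).orthogonalFamily.linearIsometry.norm_map ξ

theorem star_monomialOp_mul_self (f : P → P) (hf : Function.Injective f) (c : P → Circle) :
    star (monomialOp P f hf c) * monomialOp P f hf c = 1 := by
  rw [ContinuousLinearMap.star_eq_adjoint]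
  exact (ContinuousLinearMap.norm_map_iff_adjoint_comp_self _).1 (monomialOp_norm_apply f hf c)

theorem star_leftReg_mul_self (p : P) : star (leftReg Θ P p) * leftReg Θ P p = 1 :=
  star_monomialOp_mul_self _ _ _

/-! ### Induction principles for the reduced algebras -/

/-- The reduced algebra is closed in B(ℓ²(P)), so a closed subset of it stays closed there; it then
contains the closure of the generated *-algebra as soon as it contains that *-algebra. -/
theorem redAlg_induction {p : redAlg Θ P → Prop} (closed : IsClosed {a | p a})
    (gen : ∀ q, p (gen Θ P q)) (algebraMap : ∀ c, p (algebraMap ℂ _ c))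
    (add : ∀ a b, p a → p b → p (a + b)) (mul : ∀ a b, p a → p b → p (a * b))
    (star : ∀ a, p a → p (star a)) (a : redAlg Θ P) : p a := by
  have hcl : IsClosed ((fun a : redAlg Θ P => (a : Ell2 P →L[ℂ] Ell2 P)) '' {a | p a}) :=
    ((StarSubalgebra.isClosed_topologicalClosure _).isClosedEmbedding_subtypeVal).isClosedMap _
      closed
  have hsub : (StarAlgebra.adjoin ℂ (range (leftReg Θ P)) : Set (Ell2 P →L[ℂ] Ell2 P)) ⊆
      (fun a : redAlg Θ P => (a : Ell2 P →L[ℂ] Ell2 P)) '' {a | p a} := by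
    intro x hx
    induction hx using StarAlgebra.adjoin_induction with
    | mem x hx => obtain ⟨q, rfl⟩ := hx; exact ⟨_, gen q, rfl⟩
    | algebraMap c => exact ⟨_, algebraMap c, rfl⟩
    | add x y _ _ h1 h2 =>
      obtain ⟨a, ha, rfl⟩ := h1; obtain ⟨b, hb, rfl⟩ := h2
      exact ⟨a + b, add a b ha hb, rfl⟩
    | mul x y _ _ h1 h2 =>
      obtain ⟨a, ha, rfl⟩ := h1; obtain ⟨b, hb, rfl⟩ := h2
      exact ⟨a * b, mul a b ha hb, rfl⟩
    | star x _ h1 =>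
      obtain ⟨a, ha, rfl⟩ := h1
      exact ⟨_, star a ha, rfl⟩
  obtain ⟨b, hb, hba⟩ := closure_minimal hsub hcl a.2
  rwa [← Subtype.ext hba]

/-- A closed additive property of elements of `redAlg Θ P` that holds on a set of elements which
contains the generators and is closed under products, adjoints and scalar multiples. -/
theorem redAlg_induction_of_homogeneous {p h : redAlg Θ P → Prop} (closed : IsClosed {a | p a})
    (add : ∀ a b, p a → p b → p (a + b)) (homog : ∀ a, h a → p a) (zero : h 0)
    (gen : ∀ q, h (gen Θ P q)) (algebraMap : ∀ c, h (algebraMap ℂ _ c))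
    (mul : ∀ a b, h a → h b → h (a * b)) (star : ∀ a, h a → h (star a)) (a : redAlg Θ P) :
    p a := by
  -- Finite sums of elements satisfying `h` already form a *-algebra containing the generators,
  -- hence a dense set; additivity and closedness of `p` then suffice.
  let S : AddSubmonoid (redAlg Θ P) := AddSubmonoid.closure {a | h a}
  have hS : ∀ a ∈ S, p a := by
    intro a ha
    induction ha using AddSubmonoid.closure_induction with
    | mem x hx => exact homog x hx
    | zero => exact homog 0 zero
    | add x y _ _ h1 h2 => exact add x y h1 h2
  have hmul : ∀ a ∈ S, ∀ b ∈ S, a * b ∈ S := by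
    intro a ha b hb
    induction ha using AddSubmonoid.closure_induction with
    | mem x hx =>
      induction hb using AddSubmonoid.closure_induction with
      | mem y hy => exact AddSubmonoid.subset_closure (mul x y hx hy)
      | zero => simp
      | add y z _ _ h1 h2 => rw [mul_add]; exact add_mem h1 h2
    | zero => simp
    | add y z _ _ h1 h2 => rw [add_mul]; exact add_mem h1 h2
  have hstar : ∀ a ∈ S, Star.star a ∈ S := by
    intro a ha
    induction ha using AddSubmonoid.closure_induction with
    | mem x hx => exact AddSubmonoid.subset_closure (star x hx)
    | zero => simp
    | add y z _ _ h1 h2 => rw [star_add]; exact add_mem h1 h2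
  suffices a ∈ closure (S : Set (redAlg Θ P)) from closure_minimal hS closed this
  refine redAlg_induction (p := fun a => a ∈ closure (S : Set (redAlg Θ P))) isClosed_closure
    (fun q => subset_closure (AddSubmonoid.subset_closure (gen q)))
    (fun c => subset_closure (AddSubmonoid.subset_closure (algebraMap c)))
    (fun a b ha hb => ?_) (fun a b ha hb => ?_) (fun a ha => ?_) a
  · exact map_mem_closure₂ continuous_add ha hb fun x hx y hy => add_mem hx hy
  · exact map_mem_closure₂ continuous_mul ha hb hmul
  · exact map_mem_closure continuous_star ha hstar

/-- `a` is homogeneous of degree `x` for the gauge action. -/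
def IsHomog (a : redAlg Θ P) (x : Fin n → ℤ) : Prop :=
  ∀ z, gauge Θ P z a = (monomial z x : ℂ) • a

theorem monomial_neg (z : Fin n → Circle) (x : Fin n → ℤ) :
    monomial z (-x) = (monomial z x)⁻¹ := by
  simp [monomial]

theorem isHomog_gen (p : P) : IsHomog (gen Θ P p) p := fun z =>
  Subtype.ext (diag_conj_leftReg Θ P z p)

theorem IsHomog.mul {a b : redAlg Θ P} {x y : Fin n → ℤ} (ha : IsHomog a x) (hb : IsHomog b y) :
    IsHomog (a * b) (x + y) := fun z => by
  rw [map_mul, ha z, hb z, smul_mul_smul_comm, monomial_add, Circle.coe_mul]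

theorem gauge_star (z : Fin n → Circle) (a : redAlg Θ P) :
    gauge Θ P z (star a) = star (gauge Θ P z a) :=
  (gauge Θ P z).map_star' a

theorem IsHomog.star {a : redAlg Θ P} {x : Fin n → ℤ} (ha : IsHomog a x) :
    IsHomog (star a) (-x) := fun z => by
  rw [gauge_star, ha z, star_smul, monomial_neg, Circle.coe_inv_eq_conj]; rfl

theorem isHomog_algebraMap (c : ℂ) : IsHomog (algebraMap ℂ (redAlg Θ P) c) 0 := fun z => by
  rw [AlgHomClass.commutes]
  simp [monomial]

/-- Closed additive properties of the reduced algebra may be checked on homogeneous elements. -/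
theorem redAlg_induction_homog {p : redAlg Θ P → Prop} (closed : IsClosed {a | p a})
    (add : ∀ a b, p a → p b → p (a + b)) (homog : ∀ a x, IsHomog a x → p a) (a : redAlg Θ P) :
    p a := by
  refine redAlg_induction_of_homogeneous (h := fun a => ∃ x, IsHomog a x) closed add
    (fun a ⟨x, h⟩ => homog a x h) ⟨0, fun z => by simp⟩ (fun q => ⟨_, isHomog_gen q⟩)
    (fun c => ⟨0, isHomog_algebraMap c⟩) (fun a b ⟨x, hx⟩ ⟨y, hy⟩ => ⟨_, hx.mul hy⟩)
    (fun a ⟨x, hx⟩ => ⟨_, hx.star⟩) a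

theorem continuous_gauge (z : Fin n → Circle) : Continuous (gauge Θ P z) :=
  continuous_of_linear_of_bound (𝕜 := ℂ) (map_add _) (map_smul _) (C := 1)
    fun a => by rw [norm_gauge, one_mul]

/-! ### The noncommutative torus -/

/-- The group `ℤⁿ` as a submonoid of itself. -/
abbrev fullCone (n : ℕ) : AddSubmonoid (Fin n → ℤ) := ⊤

/-- An element of `ℤⁿ` as an element of the trivial submonoid `⊤`. -/
def toFull (x : Fin n → ℤ) : fullCone n := ⟨x, AddSubmonoid.mem_top x⟩

theorem coe_toFull (x : Fin n → ℤ) : (toFull x : Fin n → ℤ) = x := rfl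

/-- The canonical unitaries `λ_x` of the noncommutative torus, for `x ∈ ℤⁿ`. -/
def lam (Θ : Matrix (Fin n) (Fin n) ℝ) (x : Fin n → ℤ) : NCTorus Θ := gen Θ ⊤ (toFull x)

theorem lam_mul (x y : Fin n → ℤ) : lam Θ x * lam Θ y = (cocycle Θ x y : ℂ) • lam Θ (x + y) :=
  Subtype.ext (leftReg_mul (P := ⊤) _ _)

theorem lam_zero : lam Θ 0 = 1 := Subtype.ext (leftReg_zero (P := ⊤))

theorem star_lam_mul_self (x : Fin n → ℤ) : star (lam Θ x) * lam Θ x = 1 :=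
  Subtype.ext (star_leftReg_mul_self (P := ⊤) _)

/-- Antisymmetry gives σ_Θ(x, x) = 1, so no scalar appears here or in λ_x* = λ_{-x}. -/
theorem lam_mul_lam_neg (hΘ : Θᵀ = -Θ) (x : Fin n → ℤ) : lam Θ x * lam Θ (-x) = 1 := by
  rw [lam_mul, cocycle_neg_right, cocycle_self hΘ]
  simp [lam_zero]

theorem star_lam (hΘ : Θᵀ = -Θ) (x : Fin n → ℤ) : star (lam Θ x) = lam Θ (-x) :=
  left_inv_eq_right_inv (star_lam_mul_self x) (lam_mul_lam_neg hΘ x)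

theorem lam_mul_star_self (hΘ : Θᵀ = -Θ) (x : Fin n → ℤ) : lam Θ x * star (lam Θ x) = 1 := by
  rw [star_lam hΘ, lam_mul_lam_neg hΘ]

theorem isHomog_lam (x : Fin n → ℤ) : IsHomog (lam Θ x) x := isHomog_gen (P := ⊤) _

/-- Closed linear properties of the noncommutative torus may be checked on the unitaries `λ_x`. -/
theorem ncTorus_induction (hΘ : Θᵀ = -Θ) {p : NCTorus Θ → Prop} (closed : IsClosed {a | p a})
    (add : ∀ a b, p a → p b → p (a + b)) (smul_lam : ∀ (c : ℂ) x, p (c • lam Θ x))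
    (a : NCTorus Θ) : p a := by
  refine redAlg_induction_of_homogeneous (h := fun a => ∃ (c : ℂ) (x : _), a = c • lam Θ x)
    closed add (by rintro a ⟨c, x, rfl⟩; exact smul_lam c x) ⟨0, 0, by simp⟩
    (fun q => ⟨1, q, by rw [one_smul]; rfl⟩)
    (fun c => ⟨c, 0, by rw [lam_zero, Algebra.algebraMap_eq_smul_one]⟩) ?_ ?_ a
  · rintro _ _ ⟨c, x, rfl⟩ ⟨e, y, rfl⟩
    exact ⟨c * e * cocycle Θ x y, x + y, by rw [smul_mul_smul_comm, lam_mul, smul_smul]⟩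
  · rintro _ ⟨c, x, rfl⟩
    exact ⟨star c, -x, by rw [star_smul, star_lam hΘ]⟩

end

section

variable {n : ℕ} {Θ : Matrix (Fin n) (Fin n) ℝ} {r : Fin n → ℝ}

/-! ### Fourier coefficients -/

/-- The Fourier coefficient `⟨δ_x, a δ_0⟩` of an element of the noncommutative torus. -/
def coeff (Θ : Matrix (Fin n) (Fin n) ℝ) (x : Fin n → ℤ) : NCTorus Θ →L[ℂ] ℂ :=
  LinearMap.mkContinuous
    { toFun := fun a => inner ℂ (delta (fullCone n) (toFull x)) (a.1 (delta (fullCone n) 0))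
      map_add' := fun a b => inner_add_right _ _ _
      map_smul' := fun c a => inner_smul_right _ _ _ }
    (‖delta (fullCone n) (toFull x)‖ *
      ‖delta (fullCone n) (0 : fullCone n)‖) fun a => by
      refine (norm_inner_le_norm (𝕜 := ℂ) (delta (fullCone n) (toFull x)) _).trans ?_
      have := a.1.le_opNorm (delta (fullCone n) 0)
      rw [mul_assoc, mul_comm ‖delta (fullCone n) 0‖]
      exact mul_le_mul_of_nonneg_left this (norm_nonneg _)

theorem coeff_apply (x : Fin n → ℤ) (a : NCTorus Θ) :
    coeff Θ x a = inner ℂ (delta (fullCone n) (toFull x)) (a.1 (delta (fullCone n) 0)) := rfl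

theorem lam_delta (x : Fin n → ℤ) (y : (fullCone n)) :
    (lam Θ x).1 (delta (fullCone n) y) =
      (cocycle Θ x y : ℂ) • delta (fullCone n) ((toFull x) + y) :=
  leftReg_delta (P := ⊤) _ _

theorem coeff_lam_self (x : Fin n → ℤ) : coeff Θ x (lam Θ x) = 1 := by
  rw [coeff_apply, lam_delta, inner_delta]
  simp [cocycle_zero_right, delta_apply_self]

theorem coeff_lam_of_ne {x y : Fin n → ℤ} (h : x ≠ y) : coeff Θ x (lam Θ y) = 0 := by
  rw [coeff_apply, lam_delta, inner_delta]
  have : delta (fullCone n) (toFull y) (toFull x) = 0 :=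
    delta_apply_of_ne fun e => h (congrArg Subtype.val e)
  simp [cocycle_zero_right, this]

/-- The twisted right translation `δ_y ↦ σ_Θ(y, x) δ_{y+x}`. -/
def rightReg (Θ : Matrix (Fin n) (Fin n) ℝ) (x : (fullCone n)) :
    Ell2 (fullCone n) →L[ℂ] Ell2 (fullCone n) :=
  monomialOp ⊤ (fun y => y + x) (add_left_injective x) (fun y => cocycle Θ y x)

theorem rightReg_delta (x y : (fullCone n)) :
    rightReg Θ x (delta (fullCone n) y) = (cocycle Θ y x : ℂ) • delta (fullCone n) (y + x) :=
  monomialOp_delta _ _ _ _ _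

/-- This is the cocycle identity σ(q,x) σ(y,q+x) = σ(y,q) σ(y+q,x). -/
theorem lam_mul_rightReg (y : Fin n → ℤ) (x : (fullCone n)) :
    (lam Θ y).1 * rightReg Θ x = rightReg Θ x * (lam Θ y).1 := by
  apply ext_delta
  intro q
  simp only [mul_apply_eq_comp, rightReg_delta, lam_delta, map_smul, smul_smul,
    AddSubmonoid.coe_add, coe_toFull, cocycle_add_left, cocycle_add_right, add_assoc,
    Circle.coe_mul]
  congr 1
  ring

theorem ncTorus_mul_rightReg (hΘ : Θᵀ = -Θ) (x : (fullCone n))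
    (a : NCTorus Θ) : a.1 * rightReg Θ x = rightReg Θ x * a.1 := by
  refine ncTorus_induction hΘ
    (p := fun a => a.1 * rightReg Θ x = rightReg Θ x * a.1)
    (isClosed_eq (by fun_prop) (by fun_prop)) (fun a b ha hb => ?_) (fun c y => ?_) a
  · change (a.1 + b.1) * _ = _ * (a.1 + b.1)
    rw [add_mul, mul_add, ha, hb]
  · change (c • (lam Θ y).1) * _ = _ * (c • (lam Θ y).1)
    rw [smul_mul_assoc, lam_mul_rightReg, mul_smul_comm]

/-- Elements of the noncommutative torus are determined by their Fourier coefficients. -/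
theorem ncTorus_eq_of_coeff (hΘ : Θᵀ = -Θ) {a b : NCTorus Θ}
    (h : ∀ x, coeff Θ x a = coeff Θ x b) : a = b := by
  have h0 : a.1 (delta (fullCone n) 0) = b.1 (delta (fullCone n) 0) := by
    ext x
    have := h x
    rwa [coeff_apply, coeff_apply, inner_delta, inner_delta] at this
  ext1
  apply ext_delta
  intro x
  -- δ_0 is cyclic for the commuting right translations, hence separating for the algebra.
  have hx : delta (fullCone n) x = rightReg Θ x (delta (fullCone n) 0) := by
    rw [rightReg_delta]; simp [cocycle_zero_left]
  rw [hx, ← mul_apply_eq_comp, ncTorus_mul_rightReg hΘ, mul_apply_eq_comp,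
    h0, ← mul_apply_eq_comp, ← ncTorus_mul_rightReg hΘ, mul_apply_eq_comp]

theorem coeff_gauge (hΘ : Θᵀ = -Θ) (z : Fin n → Circle) (x : Fin n → ℤ) (a : NCTorus Θ) :
    coeff Θ x (gauge Θ ⊤ z a) = monomial z x * coeff Θ x a := by
  refine ncTorus_induction hΘ
    (p := fun a => coeff Θ x (gauge Θ ⊤ z a) = monomial z x * coeff Θ x a)
    (isClosed_eq ((coeff Θ x).continuous.comp (continuous_gauge z))
      (continuous_const.mul (coeff Θ x).continuous))
    (fun a b ha hb => ?_) (fun c y => ?_) a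
  · rw [map_add, map_add, map_add, ha, hb, mul_add]
  · have h1 : gauge Θ ⊤ z (c • lam Θ y) = c • (monomial z y : ℂ) • lam Θ y := by
      rw [map_smul, isHomog_lam]
    rw [h1, ContinuousLinearMap.map_smul, ContinuousLinearMap.map_smul,
      ContinuousLinearMap.map_smul, smul_eq_mul, smul_eq_mul, smul_eq_mul]
    by_cases h : x = y
    · subst h
      ring
    · rw [coeff_lam_of_ne h, mul_zero, mul_zero, mul_zero]

/-! ### The characters defining `H_n^r` -/

theorem monomial_exp (s : Fin n → ℝ) (x : Fin n → ℤ) :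
    monomial (fun j => Circle.exp (s j)) x = Circle.exp (∑ j, (x j : ℝ) * s j) := by
  have h : ∀ (t : Finset (Fin n)), ∏ j ∈ t, Circle.exp (s j) ^ x j =
      Circle.exp (∑ j ∈ t, (x j : ℝ) * s j) := by
    intro t
    induction t using Finset.induction_on with
    | empty => simp
    | insert i t hi ih =>
      rw [Finset.prod_insert hi, Finset.sum_insert hi, Circle.exp_add, ih]
      congr 1
      exact by rw [← zsmul_eq_mul, Circle.exp_zsmul]
  exact h _

/-- The element of `𝕋ⁿ` implementing `Ad λ_v` through the gauge action. -/
def innerChar (Θ : Matrix (Fin n) (Fin n) ℝ) (v : Fin n → ℤ) : Fin n → Circle :=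
  fun j => Circle.exp (-(2 * Real.pi * ((fun i => (v i : ℝ)) ᵥ* Θ) j))

theorem monomial_innerChar (v x : Fin n → ℤ) :
    monomial (innerChar Θ v) x = Circle.exp (-(2 * Real.pi * pairing Θ v x)) := by
  unfold innerChar
  rw [monomial_exp, pairing, Matrix.dotProduct_mulVec, dotProduct, Finset.mul_sum,
    ← Finset.sum_neg_distrib]
  congr 1
  exact Finset.sum_congr rfl fun j _ => by ring

/-- σ(v,x)² is the commutation factor in λ_v λ_x λ_v* = σ(v,x)² λ_x. -/
theorem monomial_innerChar_eq_cocycle (v x : Fin n → ℤ) :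
    monomial (innerChar Θ v) x = cocycle Θ v x * cocycle Θ v x := by
  rw [monomial_innerChar, cocycle, ← Circle.exp_add]
  congr 1; ring

/-- The element of `𝕋ⁿ` giving the dynamics at time `t`. -/
def dynChar (r : Fin n → ℝ) (t : ℝ) : Fin n → Circle := fun j => Circle.exp (r j * t)

theorem monomial_dynChar (t : ℝ) (x : Fin n → ℤ) :
    monomial (dynChar r t) x = Circle.exp ((∑ j, (x j : ℝ) * r j) * t) := by
  unfold dynChar
  rw [monomial_exp, Finset.sum_mul]
  simp only [mul_assoc]

theorem dynamics_eq_gauge (P : AddSubmonoid (Fin n → ℤ)) (t : ℝ) :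
    dynamics Θ P r t = gauge Θ P (dynChar r t) := rfl

theorem innerChar_mem (hΘ : Θᵀ = -Θ) (r : Fin n → ℝ) (v : Fin n → ℤ) :
    innerChar Θ v ∈ annihilator Θ r := by
  intro h hh
  obtain ⟨m, hm⟩ := hh.1 v
  rw [monomial_innerChar, pairing_swap hΘ h v, hm]
  have : -(2 * Real.pi * -(m : ℝ)) = m * (2 * Real.pi) := by ring
  rw [this, Circle.exp_eq_one]
  exact ⟨m, rfl⟩

theorem dynChar_mem (Θ : Matrix (Fin n) (Fin n) ℝ) (r : Fin n → ℝ) (t : ℝ) :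
    dynChar r t ∈ annihilator Θ r := by
  intro h hh
  have h2 : ∑ j, (h j : ℝ) * r j = 0 := hh.2
  rw [monomial_dynChar, h2]
  simp

/-- The inner and dynamical characters detect H_n^r, so no further description of the group Λ_n^r is
needed. -/
theorem mem_degGroup_of_monomial (hΘ : Θᵀ = -Θ) {x : Fin n → ℤ}
    (h1 : ∀ v, monomial (innerChar Θ v) x = 1) (h2 : ∀ t, monomial (dynChar r t) x = 1) :
    x ∈ degGroup Θ r := by
  have hpi := Real.pi_ne_zero
  refine ⟨fun v => ?_, ?_⟩
  · have h := h1 v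
    rw [monomial_innerChar, pairing_swap hΘ x v, Circle.exp_eq_one] at h
    obtain ⟨m, hm⟩ := h
    refine ⟨m, ?_⟩
    have : (2 * Real.pi) * (pairing Θ x v - m) = 0 := by linear_combination hm
    have h3 := (mul_eq_zero.1 this).resolve_left (by positivity)
    linarith
  · by_contra hne
    change ¬ (∑ j, (x j : ℝ) * r j = 0) at hne
    -- At this time the character takes the value e^{πi} = -1.
    have h := h2 (Real.pi / ∑ j, (x j : ℝ) * r j)
    rw [monomial_dynChar, mul_div_cancel₀ _ hne] at h
    have := congrArg ((↑) : Circle → ℂ) h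
    rw [Circle.coe_exp, Complex.exp_pi_mul_I] at this
    norm_num at this

theorem exists_monomial_ne_one (hΘ : Θᵀ = -Θ) {x : Fin n → ℤ} (hx : x ∉ degGroup Θ r) :
    (∃ v, monomial (innerChar Θ v) x ≠ 1) ∨ ∃ t, monomial (dynChar r t) x ≠ 1 := by
  by_contra! h
  exact hx (mem_degGroup_of_monomial hΘ h.1 h.2)

/-- Turns centrality, and later traciality, into invariance under gauge automorphisms from Λ_n^r. -/
theorem lam_conj (hΘ : Θᵀ = -Θ) (v : Fin n → ℤ) (a : NCTorus Θ) :
    lam Θ v * a * star (lam Θ v) = gauge Θ ⊤ (innerChar Θ v) a := by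
  refine ncTorus_induction hΘ
    (p := fun a => lam Θ v * a * star (lam Θ v) = gauge Θ ⊤ (innerChar Θ v) a)
    (isClosed_eq ((continuous_const.mul continuous_id).mul continuous_const) (continuous_gauge _))
    (fun a b ha hb => ?_) (fun c x => ?_) a
  · rw [mul_add, add_mul, map_add]
    exact congrArg₂ (· + ·) ha hb
  · rw [map_smul, isHomog_lam, mul_smul_comm, smul_mul_assoc, star_lam hΘ, lam_mul,
      smul_mul_assoc, lam_mul, smul_smul, monomial_innerChar_eq_cocycle, cocycle_add_left,
      cocycle_neg_right, cocycle_neg_right, cocycle_self hΘ, ← cocycle_swap hΘ x v,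
      add_neg_cancel_comm]
    simp [smul_smul, mul_assoc]

/-! ### The fixed point algebra -/

theorem lam_mem_fixedAlg {x : Fin n → ℤ} (hx : x ∈ degGroup Θ r) : lam Θ x ∈ fixedAlg Θ r :=
  fun z hz => by rw [isHomog_lam, hz x hx]; simp

theorem mem_fixedAlg_iff (hΘ : Θᵀ = -Θ) (a : NCTorus Θ) : a ∈ fixedAlg Θ r ↔
    a ∈ Set.center (NCTorus Θ) ∧ ∀ t : ℝ, dynamics Θ ⊤ r t a = a := by
  constructor
  · intro ha
    refine ⟨?_, fun t => ha _ (dynChar_mem Θ r t)⟩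
    rw [Semigroup.mem_center_iff]
    intro b
    refine ncTorus_induction hΘ (p := fun b => b * a = a * b)
      (isClosed_eq (continuous_id.mul continuous_const) (continuous_const.mul continuous_id))
      (fun b c hb hc => by rw [add_mul, mul_add, hb, hc])
      (fun c v => ?_) b
    have h : lam Θ v * a * star (lam Θ v) = a := by
      rw [lam_conj hΘ, ha _ (innerChar_mem hΘ r v)]
    rw [smul_mul_assoc, mul_smul_comm]
    congr 1
    calc lam Θ v * a = lam Θ v * a * (star (lam Θ v) * lam Θ v) := by
          rw [star_lam_mul_self, mul_one]
      _ = a * lam Θ v := by rw [← mul_assoc, h]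
  · rintro ⟨hc, hd⟩ z hz
    apply ncTorus_eq_of_coeff hΘ
    intro x
    rw [coeff_gauge hΘ]
    by_cases hx : coeff Θ x a = 0
    · simp [hx]
    -- A nonzero coefficient in degree x forces every gauge automorphism fixing a to have trivial
    -- character on x.
    · have key : ∀ w, gauge Θ ⊤ w a = a → monomial w x = 1 := by
        intro w hw
        have := coeff_gauge hΘ w x a
        rw [hw] at this
        have h1 : (monomial w x : ℂ) = 1 := by
          apply mul_right_cancel₀ hx
          rw [← this, one_mul]
        exact Circle.coe_eq_one.1 h1
      have hH : x ∈ degGroup Θ r := by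
        refine mem_degGroup_of_monomial hΘ (fun v => key _ ?_) fun t => key _ (hd t)
        rw [← lam_conj hΘ, Semigroup.mem_center_iff.1 hc, mul_assoc, lam_mul_star_self hΘ, mul_one]
      rw [hz x hH]
      simp

end

section

variable {n : ℕ} {Θ : Matrix (Fin n) (Fin n) ℝ} {P : AddSubmonoid (Fin n → ℤ)}

/-! ### Compression to `ℓ²(P)` -/

theorem orthonormal_delta (P : AddSubmonoid (Fin n → ℤ)) : Orthonormal ℂ (delta P) := by
  simpa using orthonormal_monomial P id Function.injective_id 1

theorem toFull_injective (P : AddSubmonoid (Fin n → ℤ)) :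
    Function.Injective fun q : P => toFull (q : Fin n → ℤ) :=
  fun _ _ h => Subtype.ext (Subtype.mk.inj h)

/-- The inclusion `ℓ²(P) → ℓ²(ℤⁿ)`. -/
def emb (P : AddSubmonoid (Fin n → ℤ)) : Ell2 P →L[ℂ] Ell2 (fullCone n) :=
  ((orthonormal_delta (fullCone n)).comp _
    (toFull_injective P)).orthogonalFamily.linearIsometry.toContinuousLinearMap

theorem emb_delta (q : P) : emb P (delta P q) = delta (fullCone n) (toFull q) := by
  simp [emb, delta]

theorem norm_emb_apply (ξ : Ell2 P) : ‖emb P ξ‖ = ‖ξ‖ :=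
  ((orthonormal_delta (fullCone n)).comp _
    (toFull_injective P)).orthogonalFamily.linearIsometry.norm_map ξ

/-- The restriction `ℓ²(ℤⁿ) → ℓ²(P)`. -/
def res (P : AddSubmonoid (Fin n → ℤ)) : Ell2 (fullCone n) →L[ℂ] Ell2 P :=
  ContinuousLinearMap.adjoint (emb P)

theorem res_comp_emb : res P ∘L emb P = 1 :=
  (ContinuousLinearMap.norm_map_iff_adjoint_comp_self _).1 norm_emb_apply

theorem res_delta_of_mem {x : Fin n → ℤ} (hx : x ∈ P) :
    res P (delta (fullCone n) (toFull x)) = delta P ⟨x, hx⟩ := by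
  rw [show delta (fullCone n) (toFull x) = emb P (delta P ⟨x, hx⟩) from
    (emb_delta (⟨x, hx⟩ : P)).symm, ← ContinuousLinearMap.comp_apply, res_comp_emb]
  rfl

theorem norm_emb_le : ‖emb P‖ ≤ 1 :=
  ContinuousLinearMap.opNorm_le_bound _ zero_le_one fun ξ => by rw [norm_emb_apply, one_mul]

theorem norm_res_le : ‖res P‖ ≤ 1 := by
  rw [res, LinearIsometryEquiv.norm_map]
  exact norm_emb_le

/-- λ_p leaves ℓ²(P) invariant for p in P, and L_p is its restriction. -/
theorem emb_comp_leftReg (p : P) :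
    emb P ∘L leftReg Θ P p = (lam Θ p).1 ∘L emb P := by
  apply lp.ext_continuousLinearMap (by norm_num)
  intro i
  ext1
  have : emb P (leftReg Θ P p (delta P i)) = (lam Θ p).1 (emb P (delta P i)) := by
    rw [leftReg_delta, map_smul, emb_delta, emb_delta, lam_delta]; rfl
  simpa [delta] using this

/-- Compression of operators on `ℓ²(ℤⁿ)` to `ℓ²(P)`. -/
def compress (P : AddSubmonoid (Fin n → ℤ)) :
    (Ell2 (fullCone n) →L[ℂ] Ell2 (fullCone n)) →L[ℂ] (Ell2 P →L[ℂ] Ell2 P) :=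
  LinearMap.mkContinuous
    { toFun := fun a => res P ∘L a ∘L emb P
      map_add' := fun a b => by ext1 ξ; simp
      map_smul' := fun c a => by ext1 ξ; simp } 1 fun a => by
    refine (ContinuousLinearMap.opNorm_comp_le _ _).trans ?_
    refine (mul_le_mul norm_res_le (ContinuousLinearMap.opNorm_comp_le _ _) (norm_nonneg _)
      zero_le_one).trans ?_
    gcongr
    exact mul_le_of_le_one_right (norm_nonneg _) norm_emb_le

theorem compress_apply (a : Ell2 (fullCone n) →L[ℂ] Ell2 (fullCone n)) :
    compress P a = res P ∘L a ∘L emb P := rfl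

theorem compress_star (a : Ell2 (fullCone n) →L[ℂ] Ell2 (fullCone n)) :
    compress P (star a) = star (compress P a) := by
  rw [compress_apply, compress_apply, ContinuousLinearMap.star_eq_adjoint,
    ContinuousLinearMap.star_eq_adjoint, ContinuousLinearMap.adjoint_comp,
    ContinuousLinearMap.adjoint_comp, res, ContinuousLinearMap.adjoint_adjoint]
  rfl

/-- Compression is multiplicative against L_p on the right, since λ_p maps ℓ²(P) into itself and
nothing is cut off. This partial multiplicativity is what the study of traces uses. -/
theorem compress_mul_leftReg (a : Ell2 (fullCone n) →L[ℂ] Ell2 (fullCone n)) (p : P) :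
    compress P a * leftReg Θ P p = compress P (a * (lam Θ p).1) := by
  ext1 ξ
  have := congrArg (fun T => res P (a (T ξ))) (emb_comp_leftReg (Θ := Θ) p)
  exact this

theorem compress_star_lam_mul_lam (p q : P) :
    compress P (star (lam Θ q).1 * (lam Θ p).1) = star (leftReg Θ P q) * leftReg Θ P p := by
  rw [← compress_mul_leftReg]
  congr 1
  rw [compress_star]
  congr 1
  have := compress_mul_leftReg (Θ := Θ) 1 q
  rw [one_mul, compress_apply] at this
  rw [← this]
  change (res P ∘L emb P) * _ = _
  rw [res_comp_emb, one_mul]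

/-- Every `x ∈ ℤⁿ` is a difference of elements of `ℕⁿ`. -/
theorem exists_natCone_sub (x : Fin n → ℤ) :
    ∃ p q : natCone n, x = (p : Fin n → ℤ) - q ∧ ∀ j, (p : Fin n → ℤ) j = 0 ∨
      (q : Fin n → ℤ) j = 0 := by
  -- The positive and negative parts; their disjoint supports matter only for the KMS_{0⁺} argument.
  refine ⟨⟨fun j => max (x j) 0, fun j => le_max_right _ _⟩,
    ⟨fun j => max (-x j) 0, fun j => le_max_right _ _⟩, ?_, fun j => ?_⟩
  · ext j
    simp only [Pi.sub_apply]
    omega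
  · simp only
    omega

theorem star_lam_mul_lam (hΘ : Θᵀ = -Θ) (x y : Fin n → ℤ) :
    star (lam Θ y) * lam Θ x = ((cocycle Θ y x)⁻¹ : Circle) • lam Θ (x - y) := by
  rw [star_lam hΘ, lam_mul, cocycle_neg_left, neg_add_eq_sub]; rfl

theorem lam_sub (hΘ : Θᵀ = -Θ) (x y : Fin n → ℤ) :
    lam Θ (x - y) = (cocycle Θ y x : ℂ) • (star (lam Θ y) * lam Θ x) := by
  rw [star_lam_mul_lam hΘ, Circle.smul_def, smul_smul]
  simp

theorem compress_mem (hΘ : Θᵀ = -Θ) (a : NCTorus Θ) :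
    compress (natCone n) a.1 ∈ redAlg Θ (natCone n) := by
  refine ncTorus_induction hΘ (p := fun a => compress (natCone n) a.1 ∈ redAlg Θ (natCone n))
    ?_ (fun a b ha hb => ?_) (fun c x => ?_) a
  · exact (StarSubalgebra.isClosed_topologicalClosure _).preimage
      ((compress (natCone n)).continuous.comp continuous_subtype_val)
  · change compress (natCone n) (a.1 + b.1) ∈ _
    rw [map_add]
    exact add_mem ha hb
  · obtain ⟨p, q, rfl, -⟩ := exists_natCone_sub x
    rw [lam_sub hΘ]
    change compress (natCone n) (c • (cocycle Θ q p : ℂ) • (star (lam Θ q).1 * (lam Θ p).1)) ∈ _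
    rw [map_smul, map_smul, compress_star_lam_mul_lam]
    exact SMulMemClass.smul_mem _ (SMulMemClass.smul_mem _
      (mul_mem (star_mem (gen Θ _ q).2) (gen Θ _ p).2))

/-- The contractive linear section `a ↦ V* a V` of the quotient map onto the noncommutative
torus. -/
def toepl (hΘ : Θᵀ = -Θ) : NCTorus Θ →L[ℂ] ToeplitzTorus Θ where
  toFun a := ⟨compress (natCone n) a.1, compress_mem hΘ a⟩
  map_add' a b := Subtype.ext (map_add (compress (natCone n)) a.1 b.1)
  map_smul' c a := Subtype.ext (map_smul (compress (natCone n)) c a.1)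
  cont := Continuous.subtype_mk ((compress (natCone n)).continuous.comp continuous_subtype_val) _

theorem toepl_star (hΘ : Θᵀ = -Θ) (a : NCTorus Θ) : toepl hΘ (star a) = star (toepl hΘ a) :=
  Subtype.ext (compress_star a.1)

theorem toepl_one (hΘ : Θᵀ = -Θ) : toepl hΘ 1 = 1 :=
  Subtype.ext (res_comp_emb (P := natCone n))

theorem toepl_mul_isom (hΘ : Θᵀ = -Θ) (a : NCTorus Θ) (p : natCone n) :
    toepl hΘ a * isom Θ p = toepl hΘ (a * lam Θ p) :=
  Subtype.ext (compress_mul_leftReg a.1 p)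

theorem toepl_star_lam_mul_lam (hΘ : Θᵀ = -Θ) (p q : natCone n) :
    toepl hΘ (star (lam Θ q) * lam Θ p) = star (isom Θ q) * isom Θ p :=
  Subtype.ext (compress_star_lam_mul_lam p q)

theorem toepl_lam_sub (hΘ : Θᵀ = -Θ) (p q : natCone n) :
    toepl hΘ (lam Θ (p - q)) = (cocycle Θ q p : ℂ) • (star (isom Θ q) * isom Θ p) := by
  rw [lam_sub hΘ, map_smul, toepl_star_lam_mul_lam]

theorem toepl_lam (hΘ : Θᵀ = -Θ) (p : natCone n) : toepl hΘ (lam Θ p) = isom Θ p := by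
  have := toepl_mul_isom hΘ 1 p
  rw [toepl_one, one_mul, one_mul] at this
  exact this.symm

end

section

variable {n : ℕ} {Θ : Matrix (Fin n) (Fin n) ℝ}

/-! ### The quotient map onto the noncommutative torus -/

/-- A Lipschitz bound uniform in m allows an ε/2 argument. It serves both to check strong
convergence on basis vectors and to close up sets of operators. -/
theorem isClosed_setOf_tendsto_zero {E F : Type*} [SeminormedAddCommGroup E]
    [SeminormedAddCommGroup F] (D : ℕ → E → F) (C : ℝ)
    (hD : ∀ m x y, ‖D m x - D m y‖ ≤ C * ‖x - y‖) :
    IsClosed {x | Tendsto (fun m => D m x) atTop (𝓝 0)} := by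
  refine isClosed_of_closure_subset fun x hx => ?_
  rw [mem_ofPred_eq, Metric.tendsto_atTop]
  intro ε hε
  -- |C| + 1 is positive and dominates C, whatever the sign of C.
  obtain ⟨y, hy, hxy⟩ := Metric.mem_closure_iff.1 hx (ε / 2 / (|C| + 1)) (by positivity)
  obtain ⟨N, hN⟩ := Metric.tendsto_atTop.1 hy (ε / 2) (by positivity)
  refine ⟨N, fun m hm => ?_⟩
  have h1 := hN m hm
  rw [dist_zero_right] at h1 ⊢
  rw [dist_eq_norm, lt_div_iff₀ (by positivity)] at hxy
  have h2 := hD m x y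
  have h3 : C * ‖x - y‖ ≤ ‖x - y‖ * (|C| + 1) := by
    rw [mul_comm]
    exact mul_le_mul_of_nonneg_left ((le_abs_self C).trans (by linarith)) (norm_nonneg _)
  calc ‖D m x‖ = ‖(D m x - D m y) + D m y‖ := by rw [sub_add_cancel]
    _ ≤ ‖D m x - D m y‖ + ‖D m y‖ := norm_add_le _ _
    _ < ε := by linarith

/-- Twisted right translation by `(m, …, m)`, followed by restriction to `ℓ²(ℕⁿ)`. -/
def shiftRes (Θ : Matrix (Fin n) (Fin n) ℝ) (m : ℕ) :
    Ell2 (fullCone n) →L[ℂ] Ell2 (natCone n) :=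
  res (natCone n) ∘L rightReg Θ (toFull fun _ => (m : ℤ))

theorem norm_shiftRes_apply_le (m : ℕ) (ξ : Ell2 (fullCone n)) : ‖shiftRes Θ m ξ‖ ≤ ‖ξ‖ := by
  refine ((res (natCone n)).le_of_opNorm_le norm_res_le _).trans ?_
  rw [one_mul]
  exact (monomialOp_norm_apply _ _ _ _).le

theorem shiftRes_delta {m : ℕ} {x : Fin n → ℤ} (hx : x + (fun _ => (m : ℤ)) ∈ natCone n) :
    shiftRes Θ m (delta (fullCone n) (toFull x)) =
      (cocycle Θ x (fun _ => (m : ℤ)) : ℂ) • delta (natCone n) ⟨_, hx⟩ := by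
  rw [shiftRes, ContinuousLinearMap.comp_apply, rightReg_delta, map_smul]
  congr 1
  exact res_delta_of_mem hx

theorem eventually_add_const_mem (x : Fin n → ℤ) :
    ∀ᶠ m : ℕ in atTop, x + (fun _ => (m : ℤ)) ∈ natCone n := by
  have h : ∀ j, ∀ᶠ m : ℕ in atTop, 0 ≤ x j + (m : ℤ) := fun j => by
    filter_upwards [eventually_ge_atTop (x j).natAbs] with m hm
    omega
  filter_upwards [eventually_all.2 h] with m hm j using hm j

/-- Translation by (m, …, m) eventually moves any finite set into the cone, so the restriction to
ℓ²(ℕⁿ) loses nothing in the limit. -/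
theorem tendsto_emb_shiftRes_sub (ξ : Ell2 (fullCone n)) :
    Tendsto (fun m : ℕ => emb (natCone n) (shiftRes Θ m ξ) -
      rightReg Θ (toFull fun _ => (m : ℤ)) ξ) atTop (𝓝 0) := by
  refine ell2_induction (p := fun ξ => Tendsto (fun m : ℕ => emb (natCone n) (shiftRes Θ m ξ) -
      rightReg Θ (toFull fun _ => (m : ℤ)) ξ) atTop (𝓝 0))
    ?_ ?_ (fun q => ?_) (fun ξ η h1 h2 => ?_) (fun c ξ h1 => ?_) ξ
  · refine isClosed_setOf_tendsto_zero _ 2 fun m x y => ?_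
    have e : emb (natCone n) (shiftRes Θ m x) - rightReg Θ (toFull fun _ => (m : ℤ)) x -
        (emb (natCone n) (shiftRes Θ m y) - rightReg Θ (toFull fun _ => (m : ℤ)) y) =
        emb (natCone n) (shiftRes Θ m (x - y)) -
          rightReg Θ (toFull fun _ => (m : ℤ)) (x - y) := by
      simp only [map_sub]; abel
    rw [e, two_mul]
    refine (norm_sub_le _ _).trans (add_le_add ?_ ?_)
    · rw [norm_emb_apply]
      exact norm_shiftRes_apply_le m _
    · exact (monomialOp_norm_apply _ _ _ _).le
  · simp
  · refine tendsto_const_nhds.congr' ?_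
    filter_upwards [eventually_add_const_mem (q : Fin n → ℤ)] with m hm
    rw [show q = toFull (q : Fin n → ℤ) from rfl, shiftRes_delta hm, map_smul, emb_delta,
      rightReg_delta]
    exact (sub_self _).symm
  · have := h1.add h2
    rw [add_zero] at this
    refine this.congr fun m => ?_
    simp only [map_add]
    abel
  · have := h1.const_smul c
    rw [smul_zero] at this
    refine this.congr fun m => ?_
    simp [smul_sub]

theorem tendsto_norm_shiftRes (ξ : Ell2 (fullCone n)) :
    Tendsto (fun m => ‖shiftRes Θ m ξ‖) atTop (𝓝 ‖ξ‖) := by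
  have h := (tendsto_emb_shiftRes_sub (Θ := Θ) ξ).norm
  rw [norm_zero] at h
  rw [tendsto_iff_norm_sub_tendsto_zero]
  refine squeeze_zero (fun m => norm_nonneg _) (fun m => ?_) h
  have := abs_norm_sub_norm_le (emb (natCone n) (shiftRes Θ m ξ))
    (rightReg Θ (toFull fun _ => (m : ℤ)) ξ)
  rw [norm_emb_apply, show ‖rightReg Θ (toFull fun _ => (m : ℤ)) ξ‖ = ‖ξ‖ from
    monomialOp_norm_apply _ _ _ _] at this
  exact this

/-- `b` is the operator on `ℓ²(ℤⁿ)` approximated by the translates of the operator `a` on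
`ℓ²(ℕⁿ)`. -/
def IsLimitOp (Θ : Matrix (Fin n) (Fin n) ℝ) (a : Ell2 (natCone n) →L[ℂ] Ell2 (natCone n))
    (b : Ell2 (fullCone n) →L[ℂ] Ell2 (fullCone n)) : Prop :=
  ∀ ξ, Tendsto (fun m => a (shiftRes Θ m ξ) - shiftRes Θ m (b ξ)) atTop (𝓝 0)

variable {a a' : Ell2 (natCone n) →L[ℂ] Ell2 (natCone n)}
  {b b' : Ell2 (fullCone n) →L[ℂ] Ell2 (fullCone n)}

theorem IsLimitOp.add (h : IsLimitOp Θ a b) (h' : IsLimitOp Θ a' b') :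
    IsLimitOp Θ (a + a') (b + b') := fun ξ => by
  have := (h ξ).add (h' ξ)
  rw [add_zero] at this
  refine this.congr fun m => ?_
  simp only [add_apply, map_add]
  abel

theorem IsLimitOp.smul (c : ℂ) (h : IsLimitOp Θ a b) : IsLimitOp Θ (c • a) (c • b) := fun ξ => by
  have := (h ξ).const_smul c
  rw [smul_zero] at this
  refine this.congr fun m => ?_
  simp [smul_sub]

theorem IsLimitOp.sub (h : IsLimitOp Θ a b) (h' : IsLimitOp Θ a' b') :
    IsLimitOp Θ (a - a') (b - b') := by
  simpa [sub_eq_add_neg] using h.add (h'.smul (-1))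

theorem isLimitOp_one : IsLimitOp Θ 1 1 := fun ξ => by simp

theorem IsLimitOp.mul (h : IsLimitOp Θ a b) (h' : IsLimitOp Θ a' b') :
    IsLimitOp Θ (a * a') (b * b') := fun ξ => by
  have := ((a.continuous.tendsto 0).comp (h' ξ)).add (h (b' ξ))
  rw [map_zero, add_zero] at this
  refine this.congr fun m => ?_
  simp

/-- The maps `shiftRes Θ m` are contractions and become isometric in the limit on each vector.
Contractivity yields uniqueness of the limit operator and its existence on norm closures. -/
theorem IsLimitOp.norm_le (h : IsLimitOp Θ a b) : ‖b‖ ≤ ‖a‖ := by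
  refine ContinuousLinearMap.opNorm_le_bound _ (norm_nonneg _) fun ξ => ?_
  have h1 : Tendsto (fun m => ‖a‖ * ‖ξ‖ + ‖a (shiftRes Θ m ξ) - shiftRes Θ m (b ξ)‖) atTop
      (𝓝 (‖a‖ * ‖ξ‖)) := by
    simpa using (h ξ).norm.const_add (‖a‖ * ‖ξ‖)
  refine le_of_tendsto_of_tendsto (tendsto_norm_shiftRes (Θ := Θ) (b ξ)) h1
    (Eventually.of_forall fun m => ?_)
  have h2 : ‖a (shiftRes Θ m ξ)‖ ≤ ‖a‖ * ‖ξ‖ :=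
    (a.le_opNorm _).trans (by gcongr; exact norm_shiftRes_apply_le m ξ)
  have h3 := norm_sub_norm_le (shiftRes Θ m (b ξ)) (a (shiftRes Θ m ξ))
  rw [norm_sub_rev] at h3
  change ‖shiftRes Θ m (b ξ)‖ ≤ _
  linarith

theorem IsLimitOp.unique (h : IsLimitOp Θ a b) (h' : IsLimitOp Θ a b') : b = b' := by
  have := (h.sub h').norm_le
  rw [sub_self, norm_zero, norm_le_zero_iff, sub_eq_zero] at this
  exact this

theorem isLimitOp_of_eventually
    (h : ∀ x, ∀ᶠ m in atTop, a (shiftRes Θ m (delta (fullCone n) (toFull x))) =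
      shiftRes Θ m (b (delta (fullCone n) (toFull x)))) : IsLimitOp Θ a b := fun ξ => by
  refine ell2_induction
    (p := fun ξ => Tendsto (fun m => a (shiftRes Θ m ξ) - shiftRes Θ m (b ξ)) atTop (𝓝 0))
    ?_ ?_ (fun q => ?_) (fun ξ η h1 h2 => ?_) (fun c ξ h1 => ?_) ξ
  · refine isClosed_setOf_tendsto_zero _ (‖a‖ + ‖b‖) fun m x y => ?_
    have e : a (shiftRes Θ m x) - shiftRes Θ m (b x) - (a (shiftRes Θ m y) - shiftRes Θ m (b y)) =
        a (shiftRes Θ m (x - y)) - shiftRes Θ m (b (x - y)) := by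
      simp only [map_sub]; abel
    rw [e, add_mul]
    refine (norm_sub_le _ _).trans (add_le_add ?_ ?_)
    · exact (a.le_opNorm _).trans (by gcongr; exact norm_shiftRes_apply_le m _)
    · exact (norm_shiftRes_apply_le m _).trans (b.le_opNorm _)
  · simp
  · refine tendsto_const_nhds.congr' ?_
    filter_upwards [h q] with m hm
    exact (sub_eq_zero.2 hm).symm
  · have := h1.add h2
    rw [add_zero] at this
    refine this.congr fun m => ?_
    simp only [map_add]
    abel
  · have := h1.const_smul c
    rw [smul_zero] at this
    refine this.congr fun m => ?_
    simp [smul_sub]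

theorem isClosed_isLimitOp :
    IsClosed {ab : (Ell2 (natCone n) →L[ℂ] Ell2 (natCone n)) ×
      (Ell2 (fullCone n) →L[ℂ] Ell2 (fullCone n)) | IsLimitOp Θ ab.1 ab.2} := by
  have : {ab : (Ell2 (natCone n) →L[ℂ] Ell2 (natCone n)) ×
      (Ell2 (fullCone n) →L[ℂ] Ell2 (fullCone n)) | IsLimitOp Θ ab.1 ab.2} =
      ⋂ ξ, {ab | Tendsto (fun m => ab.1 (shiftRes Θ m ξ) - shiftRes Θ m (ab.2 ξ)) atTop (𝓝 0)} := by
    ext ab; simp [IsLimitOp]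
  rw [this]
  refine isClosed_iInter fun ξ => isClosed_setOf_tendsto_zero _ (2 * ‖ξ‖) fun m x y => ?_
  have e : x.1 (shiftRes Θ m ξ) - shiftRes Θ m (x.2 ξ) -
      (y.1 (shiftRes Θ m ξ) - shiftRes Θ m (y.2 ξ)) =
      (x - y).1 (shiftRes Θ m ξ) - shiftRes Θ m ((x - y).2 ξ) := by
    simp only [Prod.fst_sub, Prod.snd_sub, sub_apply, map_sub]
    abel
  rw [e]
  refine (norm_sub_le _ _).trans ?_
  have h1 : ‖(x - y).1 (shiftRes Θ m ξ)‖ ≤ ‖x - y‖ * ‖ξ‖ :=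
    ((x - y).1.le_opNorm _).trans
      (mul_le_mul (norm_fst_le _) (norm_shiftRes_apply_le m _) (norm_nonneg _) (norm_nonneg _))
  have h2 : ‖shiftRes Θ m ((x - y).2 ξ)‖ ≤ ‖x - y‖ * ‖ξ‖ :=
    (norm_shiftRes_apply_le m _).trans (((x - y).2.le_opNorm _).trans
      (mul_le_mul_of_nonneg_right (norm_snd_le _) (norm_nonneg _)))
  linarith

/-! ### Limit operators of the generators and existence in general. -/

theorem isLimitOp_leftReg (p : natCone n) :
    IsLimitOp Θ (leftReg Θ (natCone n) p) (lam Θ p).1 := by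
  refine isLimitOp_of_eventually fun x => ?_
  filter_upwards [eventually_add_const_mem x] with m hm
  have hm' : (p : Fin n → ℤ) + x + (fun _ => (m : ℤ)) ∈ natCone n := by
    rw [add_assoc]; exact add_mem p.2 hm
  rw [lam_delta, shiftRes_delta hm, map_smul, map_smul, leftReg_delta]
  change _ = _ • shiftRes Θ m (delta (fullCone n) (toFull ((p : Fin n → ℤ) + x)))
  rw [shiftRes_delta hm', smul_smul, smul_smul]
  have : p + ⟨_, hm⟩ = (⟨_, hm'⟩ : natCone n) := Subtype.ext (add_assoc _ _ _).symm
  rw [this]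
  congr 1
  simp only [coe_toFull, cocycle_add_left, cocycle_add_right, Circle.coe_mul]
  ring

theorem star_leftReg_delta_add (P : AddSubmonoid (Fin n → ℤ)) (p q : P) :
    star (leftReg Θ P p) (delta P (p + q)) = ((cocycle Θ p q)⁻¹ : Circle) • delta P q := by
  have h1 := congrArg (fun T : Ell2 P →L[ℂ] Ell2 P => T (delta P q))
    (star_leftReg_mul_self (Θ := Θ) p)
  simp only [mul_apply_eq_comp, leftReg_delta, map_smul] at h1
  have h2 : delta P q = (cocycle Θ p q : ℂ) • star (leftReg Θ P p) (delta P (p + q)) := h1.symm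
  rw [Circle.smul_def, h2, smul_smul]
  simp

/-- L_p* is a backward shift away from the boundary of the cone, and x + (m, …, m) - p is eventually
in the cone. -/
theorem isLimitOp_star_leftReg (hΘ : Θᵀ = -Θ) (p : natCone n) :
    IsLimitOp Θ (star (leftReg Θ (natCone n) p)) (star (lam Θ p)).1 := by
  refine isLimitOp_of_eventually fun x => ?_
  filter_upwards [eventually_add_const_mem (-(p : Fin n → ℤ) + x)] with m hm
  have hm' : x + (fun _ => (m : ℤ)) ∈ natCone n := by
    have := add_mem p.2 hm
    rwa [add_assoc, add_neg_cancel_left] at this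
  rw [star_lam hΘ, lam_delta, shiftRes_delta hm', map_smul, map_smul]
  change _ = _ • shiftRes Θ m (delta (fullCone n) (toFull (-(p : Fin n → ℤ) + x)))
  rw [shiftRes_delta hm]
  have : (⟨_, hm'⟩ : natCone n) = p + ⟨_, hm⟩ := Subtype.ext (by simp [add_assoc])
  rw [this, star_leftReg_delta_add, Circle.smul_def, smul_smul, smul_smul]
  congr 1
  simp only [coe_toFull, cocycle_add_left, cocycle_add_right, cocycle_neg_left, Circle.coe_mul,
    cocycle_neg_right, cocycle_self hΘ, inv_one, mul_inv, Circle.coe_inv, one_mul]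
  field_simp

theorem isLimitOp_algebraMap (c : ℂ) :
    IsLimitOp Θ (algebraMap ℂ (ToeplitzTorus Θ) c).1 (algebraMap ℂ (NCTorus Θ) c).1 := by
  change IsLimitOp Θ (algebraMap ℂ (Ell2 (natCone n) →L[ℂ] Ell2 (natCone n)) c)
    (algebraMap ℂ (Ell2 (fullCone n) →L[ℂ] Ell2 (fullCone n)) c)
  rw [Algebra.algebraMap_eq_smul_one, Algebra.algebraMap_eq_smul_one]
  exact isLimitOp_one.smul c

/-- If x_i converges, contractivity makes the partners y_i Cauchy, and completeness supplies a
partner for the limit. -/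
theorem isClosed_exists_of_dist_le {X Y : Type*} [PseudoMetricSpace X] [PseudoMetricSpace Y]
    [CompleteSpace Y] {s : Set (X × Y)} (hs : IsClosed s)
    (h : ∀ p ∈ s, ∀ q ∈ s, dist p.2 q.2 ≤ dist p.1 q.1) : IsClosed {x | ∃ y, (x, y) ∈ s} := by
  refine isClosed_of_closure_subset fun x hx => ?_
  obtain ⟨u, hu, hux⟩ := mem_closure_iff_seq_limit.1 hx
  choose v hv using hu
  have hcau : CauchySeq v := by
    rw [Metric.cauchySeq_iff]
    intro ε hε
    obtain ⟨N, hN⟩ := Metric.cauchySeq_iff.1 hux.cauchySeq ε hε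
    exact ⟨N, fun i hi j hj => lt_of_le_of_lt (h _ (hv i) _ (hv j)) (hN i hi j hj)⟩
  obtain ⟨y, hy⟩ := cauchySeq_tendsto_of_complete hcau
  exact ⟨y, hs.mem_of_tendsto (hux.prodMk_nhds hy) (Eventually.of_forall hv)⟩

theorem isClosed_exists_isLimitOp :
    IsClosed {a : Ell2 (natCone n) →L[ℂ] Ell2 (natCone n) | ∃ b, b ∈ redAlg Θ (fullCone n) ∧
      IsLimitOp Θ a b ∧ IsLimitOp Θ (star a) (star b)} := by
  refine isClosed_exists_of_dist_le
    (s := {ab : (Ell2 (natCone n) →L[ℂ] Ell2 (natCone n)) ×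
      (Ell2 (fullCone n) →L[ℂ] Ell2 (fullCone n)) | ab.2 ∈ redAlg Θ (fullCone n) ∧
      IsLimitOp Θ ab.1 ab.2 ∧ IsLimitOp Θ (star ab.1) (star ab.2)}) ?_ ?_
  · exact ((StarSubalgebra.isClosed_topologicalClosure _).preimage continuous_snd).inter
      (isClosed_isLimitOp.inter (isClosed_isLimitOp.preimage
        (continuous_star.prodMap continuous_star)))
  · intro p hp q hq
    rw [dist_eq_norm, dist_eq_norm]
    exact (hp.2.1.sub hq.2.1).norm_le

/-- The adjoint is tracked separately because strong convergence alone does not pass to adjoints;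
this is what makes `quot` a *-homomorphism. -/
theorem exists_isLimitOp (hΘ : Θᵀ = -Θ) (c : ToeplitzTorus Θ) :
    ∃ b : NCTorus Θ, IsLimitOp Θ c.1 b.1 ∧ IsLimitOp Θ (star c).1 (star b).1 := by
  refine redAlg_induction (p := fun c : ToeplitzTorus Θ =>
    ∃ b : NCTorus Θ, IsLimitOp Θ c.1 b.1 ∧ IsLimitOp Θ (star c).1 (star b).1)
    ?_ (fun q => ?_) (fun c => ?_) ?_ ?_ ?_ c
  · convert (isClosed_exists_isLimitOp (Θ := Θ)).preimage
      (continuous_subtype_val (p := fun a => a ∈ redAlg Θ (natCone n))) using 1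
    ext c
    exact ⟨fun ⟨b, hb⟩ => ⟨b.1, b.2, hb⟩, fun ⟨b, h, hb⟩ => ⟨⟨b, h⟩, hb⟩⟩
  · exact ⟨lam Θ q, isLimitOp_leftReg q, isLimitOp_star_leftReg hΘ q⟩
  · refine ⟨algebraMap ℂ _ c, isLimitOp_algebraMap c, ?_⟩
    rw [← algebraMap_star_comm, ← algebraMap_star_comm]
    exact isLimitOp_algebraMap (star c)
  · rintro a a' ⟨b, h1, h2⟩ ⟨b', h1', h2'⟩
    refine ⟨b + b', h1.add h1', ?_⟩
    rw [star_add, star_add]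
    exact h2.add h2'
  · rintro a a' ⟨b, h1, h2⟩ ⟨b', h1', h2'⟩
    refine ⟨b * b', h1.mul h1', ?_⟩
    rw [star_mul, star_mul]
    exact h2'.mul h2
  · rintro a ⟨b, h1, h2⟩
    exact ⟨star b, h2, by rwa [star_star, star_star]⟩

/-- The value of the quotient map. -/
def quotFun (hΘ : Θᵀ = -Θ) (c : ToeplitzTorus Θ) : NCTorus Θ := (exists_isLimitOp hΘ c).choose

theorem isLimitOp_quotFun (hΘ : Θᵀ = -Θ) (c : ToeplitzTorus Θ) :
    IsLimitOp Θ c.1 (quotFun hΘ c).1 := (exists_isLimitOp hΘ c).choose_spec.1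

theorem quotFun_eq (hΘ : Θᵀ = -Θ) {c : ToeplitzTorus Θ} {b : NCTorus Θ}
    (h : IsLimitOp Θ c.1 b.1) : quotFun hΘ c = b :=
  Subtype.ext ((isLimitOp_quotFun hΘ c).unique h)

/-- The quotient map `𝒯_r(ℕⁿ, σ_Θ) → 𝒜_Θ`. -/
def quot (hΘ : Θᵀ = -Θ) : ToeplitzTorus Θ →⋆ₐ[ℂ] NCTorus Θ where
  toFun := quotFun hΘ
  map_one' := quotFun_eq hΘ isLimitOp_one
  map_mul' a b := quotFun_eq hΘ ((isLimitOp_quotFun hΘ a).mul (isLimitOp_quotFun hΘ b))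
  map_zero' := quotFun_eq hΘ fun ξ => by simp
  map_add' a b := quotFun_eq hΘ ((isLimitOp_quotFun hΘ a).add (isLimitOp_quotFun hΘ b))
  commutes' c := quotFun_eq hΘ (isLimitOp_algebraMap c)
  map_star' a := by
    obtain ⟨b, h1, h2⟩ := exists_isLimitOp hΘ a
    rw [quotFun_eq hΘ h1, quotFun_eq hΘ h2]

theorem quot_star (hΘ : Θᵀ = -Θ) (c : ToeplitzTorus Θ) :
    quot hΘ (star c) = star (quot hΘ c) :=
  (quot hΘ).map_star' c

theorem norm_quot_le (hΘ : Θᵀ = -Θ) (c : ToeplitzTorus Θ) : ‖quot hΘ c‖ ≤ ‖c‖ :=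
  (isLimitOp_quotFun hΘ c).norm_le

theorem quot_isom (hΘ : Θᵀ = -Θ) (p : natCone n) : quot hΘ (isom Θ p) = lam Θ p :=
  quotFun_eq hΘ (isLimitOp_leftReg p)

theorem continuous_quot (hΘ : Θᵀ = -Θ) : Continuous (quot hΘ) :=
  continuous_of_linear_of_bound (𝕜 := ℂ) (map_add _) (map_smul _) (C := 1)
    fun c => by rw [one_mul]; exact norm_quot_le hΘ c

theorem quot_toepl (hΘ : Θᵀ = -Θ) (a : NCTorus Θ) : quot hΘ (toepl hΘ a) = a := by
  refine ncTorus_induction hΘ (p := fun a => quot hΘ (toepl hΘ a) = a)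
    (isClosed_eq ((continuous_quot hΘ).comp (toepl hΘ).continuous) continuous_id)
    (fun a b ha hb => by rw [map_add, map_add, ha, hb]) (fun c x => ?_) a
  obtain ⟨p, q, rfl, -⟩ := exists_natCone_sub x
  rw [map_smul, map_smul, toepl_lam_sub, map_smul, map_mul, quot_star, quot_isom, quot_isom,
    ← lam_sub hΘ]

theorem quot_gauge (hΘ : Θᵀ = -Θ) (z : Fin n → Circle) (c : ToeplitzTorus Θ) :
    quot hΘ (gauge Θ (natCone n) z c) = gauge Θ ⊤ z (quot hΘ c) := by
  refine redAlg_induction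
    (p := fun c : ToeplitzTorus Θ => quot hΘ (gauge Θ (natCone n) z c) = gauge Θ ⊤ z (quot hΘ c))
    (isClosed_eq ((continuous_quot hΘ).comp (continuous_gauge z))
      ((continuous_gauge z).comp (continuous_quot hΘ))) (fun q => ?_) (fun c => ?_)
    (fun a b ha hb => ?_) (fun a b ha hb => ?_) (fun a ha => ?_) c
  · rw [isHomog_gen, map_smul]
    change _ • quot hΘ (isom Θ q) = gauge Θ ⊤ z (quot hΘ (isom Θ q))
    rw [quot_isom, isHomog_lam]
  · simp only [AlgHomClass.commutes]
  · simp only [map_add, ha, hb]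
  · simp only [map_mul, ha, hb]
  · exact (congrArg (quot hΘ) (gauge_star z a)).trans ((quot_star hΘ _).trans
      ((congrArg star ha).trans ((gauge_star z _).symm.trans
        (congrArg (gauge Θ ⊤ z) (quot_star hΘ a).symm))))

end

section

variable {n : ℕ} {Θ : Matrix (Fin n) (Fin n) ℝ} {r : Fin n → ℝ}

/-! ### The conditional expectation -/

theorem continuous_monomial (x : Fin n → ℤ) :
    Continuous fun z : Fin n → Circle => (monomial z x : ℂ) := by
  unfold monomial
  fun_prop

/-- On homogeneous elements the orbit is a monomial times a fixed element. Gauge automorphisms are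
isometric, so norm limits of elements give uniform limits of orbits. -/
theorem continuous_gauge_orbit {P : AddSubmonoid (Fin n → ℤ)} (a : redAlg Θ P) :
    Continuous fun z => gauge Θ P z a := by
  refine redAlg_induction_homog (p := fun a => Continuous fun z => gauge Θ P z a) ?_
    (fun a b ha hb => ?_) (fun a x ha => ?_) a
  · refine isClosed_of_closure_subset fun a ha => ?_
    refine continuous_of_uniform_approx_of_continuous fun u hu => ?_
    obtain ⟨ε, hε, hu⟩ := Metric.mem_uniformity_dist.1 hu
    obtain ⟨b, hb, hab⟩ := Metric.mem_closure_iff.1 ha ε hε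
    refine ⟨_, hb, fun z => hu ?_⟩
    rw [dist_eq_norm, ← map_sub, norm_gauge, ← dist_eq_norm]
    exact hab
  · exact (ha.add hb).congr fun z => (map_add (gauge Θ P z) a b).symm
  · exact ((continuous_monomial x).smul continuous_const).congr fun z => (ha z).symm

theorem isProbabilityMeasure_haarProb (Θ : Matrix (Fin n) (Fin n) ℝ) (r : Fin n → ℝ) :
    letI : MeasurableSpace (annihilator Θ r) := borel _
    IsProbabilityMeasure (haarProb Θ r) := by
  let _ : MeasurableSpace (annihilator Θ r) := borel _
  have : BorelSpace (annihilator Θ r) := ⟨rfl⟩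
  exact ⟨Measure.haarMeasure_self⟩

theorem integrable_gauge (a : NCTorus Θ) :
    letI : MeasurableSpace (annihilator Θ r) := borel _
    Integrable (fun z : annihilator Θ r => gauge Θ ⊤ z a) (haarProb Θ r) := by
  let _ : MeasurableSpace (annihilator Θ r) := borel _
  have : BorelSpace (annihilator Θ r) := ⟨rfl⟩
  have := isProbabilityMeasure_haarProb Θ r
  have hc : Continuous fun z : annihilator Θ r => gauge Θ ⊤ (z : Fin n → Circle) a :=
    (continuous_gauge_orbit a).comp continuous_subtype_val
  exact hc.integrable_of_hasCompactSupport (HasCompactSupport.of_compactSpace _)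

theorem gaugeAverage_add (a b : NCTorus Θ) :
    gaugeAverage Θ r (a + b) = gaugeAverage Θ r a + gaugeAverage Θ r b := by
  let _ : MeasurableSpace (annihilator Θ r) := borel _
  refine Eq.trans ?_ (integral_add (integrable_gauge (r := r) a) (integrable_gauge b))
  exact integral_congr_ae (Eventually.of_forall fun z => map_add (gauge Θ ⊤ z) a b)

theorem gaugeAverage_smul (c : ℂ) (a : NCTorus Θ) :
    gaugeAverage Θ r (c • a) = c • gaugeAverage Θ r a := by
  let _ : MeasurableSpace (annihilator Θ r) := borel _
  refine Eq.trans ?_ (integral_smul c _)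
  exact integral_congr_ae (Eventually.of_forall fun z => map_smul (gauge Θ ⊤ z) c a)

theorem norm_gaugeAverage_le (a : NCTorus Θ) : ‖gaugeAverage Θ r a‖ ≤ ‖a‖ := by
  let _ : MeasurableSpace (annihilator Θ r) := borel _
  have := isProbabilityMeasure_haarProb Θ r
  have := norm_integral_le_of_norm_le_const (μ := haarProb Θ r) (C := ‖a‖)
    (f := fun z : annihilator Θ r => gauge Θ ⊤ (z : Fin n → Circle) a)
    (Eventually.of_forall fun z => (norm_gauge Θ ⊤ z a).le)
  rwa [probReal_univ, mul_one] at this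

theorem gaugeAverage_of_mem {a : NCTorus Θ} (ha : a ∈ fixedAlg Θ r) :
    gaugeAverage Θ r a = a := by
  let _ : MeasurableSpace (annihilator Θ r) := borel _
  have := isProbabilityMeasure_haarProb Θ r
  refine Eq.trans (integral_congr_ae (Eventually.of_forall fun z => ha z z.2)) ?_
  rw [integral_const, probReal_univ, one_smul]

/-- The average is a multiple of λ_x and is Λ_n^r-invariant, yet some w in Λ_n^r has w^x ≠ 1. -/
theorem gaugeAverage_lam_of_notMem (hΘ : Θᵀ = -Θ) {x : Fin n → ℤ} (hx : x ∉ degGroup Θ r) :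
    gaugeAverage Θ r (lam Θ x) = 0 := by
  obtain ⟨w, hw, hwx⟩ : ∃ w ∈ annihilator Θ r, monomial w x ≠ 1 := by
    rcases exists_monomial_ne_one hΘ hx with ⟨v, hv⟩ | ⟨t, ht⟩
    · exact ⟨_, innerChar_mem hΘ r v, hv⟩
    · exact ⟨_, dynChar_mem Θ r t, ht⟩
  have hsmul : ∃ c : ℂ, gaugeAverage Θ r (lam Θ x) = c • lam Θ x := by
    let _ : MeasurableSpace (annihilator Θ r) := borel _
    refine ⟨∫ z : annihilator Θ r, (monomial (z : Fin n → Circle) x : ℂ) ∂(haarProb Θ r), ?_⟩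
    rw [← integral_smul_const]
    exact integral_congr_ae (Eventually.of_forall fun z => isHomog_lam x z)
  obtain ⟨c, hc⟩ := hsmul
  have h1 := gaugeAverage_mem Θ r (lam Θ x) w hw
  rw [hc, map_smul, isHomog_lam] at h1
  have h2 := congrArg (coeff Θ x) h1
  simp only [map_smul, coeff_lam_self, smul_eq_mul, mul_one] at h2
  have h3 : c = 0 := by
    by_contra h0
    exact hwx (Circle.coe_eq_one.1 (mul_left_cancel₀ h0 (by rw [h2, mul_one])))
  rw [hc, h3, zero_smul]

theorem continuous_gaugeAverage : Continuous (gaugeAverage Θ r) :=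
  continuous_of_linear_of_bound (𝕜 := ℂ) (E := NCTorus Θ) (G := NCTorus Θ) gaugeAverage_add
    gaugeAverage_smul (C := 1) fun a => by rw [one_mul]; exact norm_gaugeAverage_le a

/-- The conditional expectation as a continuous linear map. -/
def condExp (Θ : Matrix (Fin n) (Fin n) ℝ) (r : Fin n → ℝ) : NCTorus Θ →L[ℂ] fixedAlg Θ r where
  toFun := condExpAnn Θ r
  map_add' a b := Subtype.ext (gaugeAverage_add a b)
  map_smul' c a := Subtype.ext (gaugeAverage_smul c a)
  cont := Continuous.subtype_mk continuous_gaugeAverage _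

theorem condExp_of_mem {a : NCTorus Θ} (ha : a ∈ fixedAlg Θ r) : condExp Θ r a = ⟨a, ha⟩ :=
  Subtype.ext (gaugeAverage_of_mem ha)

theorem condExp_lam_of_notMem (hΘ : Θᵀ = -Θ) {x : Fin n → ℤ} (hx : x ∉ degGroup Θ r) :
    condExp Θ r (lam Θ x) = 0 :=
  Subtype.ext (gaugeAverage_lam_of_notMem hΘ hx)

/-! ### Functionals supported on `H_n^r` -/

theorem functional_gauge (hΘ : Θᵀ = -Θ) {τ : NCTorus Θ →L[ℂ] ℂ}
    (hτ : ∀ x, x ∉ degGroup Θ r → τ (lam Θ x) = 0) {w : Fin n → Circle}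
    (hw : w ∈ annihilator Θ r) (a : NCTorus Θ) : τ (gauge Θ ⊤ w a) = τ a := by
  refine ncTorus_induction hΘ (p := fun a => τ (gauge Θ ⊤ w a) = τ a)
    (isClosed_eq (τ.continuous.comp (continuous_gauge w)) τ.continuous)
    (fun a b ha hb => ?_) (fun c x => ?_) a
  · rw [map_add, map_add, map_add]
    exact congrArg₂ (· + ·) ha hb
  · rw [map_smul, isHomog_lam]
    by_cases hx : x ∈ degGroup Θ r
    · rw [hw x hx, Circle.coe_one, one_smul]
    · simp only [map_smul, hτ x hx, smul_zero]

/-- Such a functional is invariant under Λ_n^r, hence under every Ad λ_v; apply this to b λ_v. -/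
theorem functional_mul_comm (hΘ : Θᵀ = -Θ) {τ : NCTorus Θ →L[ℂ] ℂ}
    (hτ : ∀ x, x ∉ degGroup Θ r → τ (lam Θ x) = 0) (a b : NCTorus Θ) :
    τ (a * b) = τ (b * a) := by
  refine ncTorus_induction hΘ (p := fun a => τ (a * b) = τ (b * a))
    (isClosed_eq (τ.continuous.comp (continuous_id.mul continuous_const))
      (τ.continuous.comp (continuous_const.mul continuous_id)))
    (fun a c ha hc => ?_) (fun c v => ?_) a
  · rw [add_mul, mul_add, map_add, map_add]
    exact congrArg₂ (· + ·) ha hc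
  · have h := functional_gauge hΘ hτ (innerChar_mem hΘ r v) (b * lam Θ v)
    rw [← lam_conj hΘ, mul_assoc (lam Θ v), mul_assoc b, lam_mul_star_self hΘ, mul_one] at h
    rw [smul_mul_assoc, mul_smul_comm, map_smul, map_smul, h]

/-- `H_n^r` as a subgroup of `ℤⁿ`. -/
def degSubgroup (Θ : Matrix (Fin n) (Fin n) ℝ) (r : Fin n → ℝ) : AddSubgroup (Fin n → ℤ) where
  carrier := degGroup Θ r
  zero_mem' := ⟨fun v => ⟨0, by simp [pairing_zero_left]⟩, by simp⟩
  add_mem' := fun {x y} hx hy => by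
    refine ⟨fun v => ?_, ?_⟩
    · obtain ⟨l, hl⟩ := hx.1 v
      obtain ⟨m, hm⟩ := hy.1 v
      exact ⟨l + m, by rw [pairing_add_left, hl, hm]; push_cast; rfl⟩
    · have h1 : ∑ j, (x j : ℝ) * r j = 0 := hx.2
      have h2 : ∑ j, (y j : ℝ) * r j = 0 := hy.2
      change ∑ j, ((x + y) j : ℝ) * r j = 0
      simp [add_mul, Finset.sum_add_distrib, h1, h2]
  neg_mem' := fun {x} hx => by
    refine ⟨fun v => ?_, ?_⟩
    · obtain ⟨l, hl⟩ := hx.1 v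
      exact ⟨-l, by rw [pairing_neg_left, hl]; push_cast; rfl⟩
    · have h1 : ∑ j, (x j : ℝ) * r j = 0 := hx.2
      change ∑ j, ((-x) j : ℝ) * r j = 0
      simp [h1]

theorem dense_span_lam (hΘ : Θᵀ = -Θ) (a : NCTorus Θ) :
    a ∈ closure (Submodule.span ℂ (range (lam Θ)) : Set (NCTorus Θ)) :=
  ncTorus_induction hΘ
    (p := fun a => a ∈ closure (Submodule.span ℂ (range (lam Θ)) : Set (NCTorus Θ)))
    isClosed_closure
    (fun _ _ ha hb => map_mem_closure₂ continuous_add ha hb fun _ hx _ hy => add_mem hx hy)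
    (fun c x => subset_closure (Submodule.smul_mem _ c (Submodule.subset_span ⟨x, rfl⟩))) a

theorem star_lam_mul_lam_mem (hΘ : Θᵀ = -Θ) {x y : Fin n → ℤ} (h : y - x ∈ degGroup Θ r) :
    star (lam Θ x) * lam Θ y ∈ fixedAlg Θ r := by
  rw [star_lam_mul_lam hΘ, Circle.smul_def]
  exact SMulMemClass.smul_mem _ (lam_mem_fixedAlg h)

/-- The sum `∑ c_x λ_x` over those `x` in the support of `c` whose label is `k`. -/
def partialSum (Θ : Matrix (Fin n) (Fin n) ℝ) (rep : (Fin n → ℤ) → (Fin n → ℤ))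
    (c : (Fin n → ℤ) →₀ ℂ) (k : Fin n → ℤ) : NCTorus Θ :=
  ∑ x ∈ c.support with rep x = k, c x • lam Θ x

theorem functional_star_partialSum_mul (hΘ : Θᵀ = -Θ) {τ : NCTorus Θ →L[ℂ] ℂ}
    (hτ : ∀ x, x ∉ degGroup Θ r → τ (lam Θ x) = 0) {rep : (Fin n → ℤ) → (Fin n → ℤ)}
    (hrep : ∀ x y, rep x ≠ rep y → y - x ∉ degGroup Θ r) (c : (Fin n → ℤ) →₀ ℂ)
    {k l : Fin n → ℤ} (hkl : k ≠ l) :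
    τ (star (partialSum Θ rep c k) * partialSum Θ rep c l) = 0 := by
  unfold partialSum
  rw [star_sum, Finset.sum_mul_sum, map_sum]
  refine Finset.sum_eq_zero fun x hx => ?_
  rw [map_sum]
  refine Finset.sum_eq_zero fun y hy => ?_
  have h : y - x ∉ degGroup Θ r := by
    apply hrep
    rw [(Finset.mem_filter.1 hx).2, (Finset.mem_filter.1 hy).2]
    exact hkl
  rw [star_smul, smul_mul_smul_comm, star_lam_mul_lam hΘ, Circle.smul_def, map_smul, map_smul,
    hτ _ h, smul_zero, smul_zero]

/-- Multiplying by the unitary λ_k* moves the degrees from the coset of k into H_n^r, where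
positivity is known, and leaves b*b unchanged. -/
theorem functional_star_partialSum_mul_self_nonneg (hΘ : Θᵀ = -Θ) {τ : NCTorus Θ →L[ℂ] ℂ}
    (hpos : ∀ a ∈ fixedAlg Θ r, 0 ≤ τ (star a * a)) {rep : (Fin n → ℤ) → (Fin n → ℤ)}
    (hrep : ∀ x, x - rep x ∈ degGroup Θ r) (c : (Fin n → ℤ) →₀ ℂ) (k : Fin n → ℤ) :
    0 ≤ τ (star (partialSum Θ rep c k) * partialSum Θ rep c k) := by
  have hb : star (lam Θ k) * partialSum Θ rep c k ∈ fixedAlg Θ r := by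
    unfold partialSum
    rw [Finset.mul_sum]
    refine sum_mem fun x hx => ?_
    rw [mul_smul_comm]
    refine SMulMemClass.smul_mem _ (star_lam_mul_lam_mem hΘ ?_)
    rw [← (Finset.mem_filter.1 hx).2]
    exact hrep x
  have he : star (partialSum Θ rep c k) * partialSum Θ rep c k =
      star (star (lam Θ k) * partialSum Θ rep c k) * (star (lam Θ k) * partialSum Θ rep c k) := by
    rw [star_mul, star_star, mul_assoc, ← mul_assoc (lam Θ k), lam_mul_star_self hΘ, one_mul]
  rw [he]
  exact hpos _ hb

/-- A functional supported on `H_n^r` is positive if it is positive on the fixed point algebra. -/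
theorem functional_nonneg (hΘ : Θᵀ = -Θ) {τ : NCTorus Θ →L[ℂ] ℂ}
    (hτ : ∀ x, x ∉ degGroup Θ r → τ (lam Θ x) = 0)
    (hpos : ∀ a ∈ fixedAlg Θ r, 0 ≤ τ (star a * a)) (a : NCTorus Θ) :
    0 ≤ τ (star a * a) := by
  have hcl : IsClosed {a : NCTorus Θ | 0 ≤ τ (star a * a)} :=
    isClosed_Ici.preimage (τ.continuous.comp (continuous_star.mul continuous_id))
  refine closure_minimal (fun a ha => ?_) hcl (dense_span_lam hΘ a)
  obtain ⟨c, rfl⟩ := Finsupp.mem_span_range_iff_exists_finsupp.1 ha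
  -- Group the terms by cosets of H_n^r: cross terms between different cosets vanish under τ, and
  -- each diagonal term is nonnegative.
  let rep : (Fin n → ℤ) → (Fin n → ℤ) := fun x =>
    Quotient.out (QuotientAddGroup.mk x : (Fin n → ℤ) ⧸ degSubgroup Θ r)
  have hmk : ∀ x, (QuotientAddGroup.mk (rep x) : (Fin n → ℤ) ⧸ degSubgroup Θ r) =
      QuotientAddGroup.mk x := fun x => Quotient.out_eq _
  have hrep : ∀ x y, rep x ≠ rep y → y - x ∉ degGroup Θ r := by
    intro x y hxy h
    apply hxy
    simp only [rep]
    congr 1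
    rw [QuotientAddGroup.eq, neg_add_eq_sub]
    exact h
  have hrep' : ∀ x, x - rep x ∈ degGroup Θ r := by
    intro x
    have := QuotientAddGroup.eq.1 (hmk x)
    rwa [neg_add_eq_sub] at this
  have hsum : (c.sum fun x e => e • lam Θ x) =
      ∑ k ∈ c.support.image rep, partialSum Θ rep c k :=
    (Finset.sum_fiberwise_of_maps_to (fun x hx => Finset.mem_image_of_mem rep hx) _).symm
  change 0 ≤ τ (star (c.sum fun x e => e • lam Θ x) * c.sum fun x e => e • lam Θ x)
  rw [hsum, star_sum, Finset.sum_mul_sum, map_sum]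
  refine Finset.sum_nonneg fun k _ => ?_
  rw [map_sum]
  refine Finset.sum_nonneg fun l _ => ?_
  by_cases hkl : k = l
  · subst hkl
    exact functional_star_partialSum_mul_self_nonneg hΘ hpos hrep' c k
  · exact (functional_star_partialSum_mul hΘ hτ hrep c hkl).ge

end

section

/-! ### Positive functionals -/

section Positive

variable {A : Type*} [NormedRing A] [StarRing A] [NormedAlgebra ℂ A] [StarModule ℂ A]
  {φ : A →L[ℂ] ℂ}

theorem positive_expand (b e : A) (t : ℂ) : φ (star (b + t • e) * (b + t • e)) =
    φ (star b * b) + t * φ (star b * e) + star t * φ (star e * b) +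
      star t * t * φ (star e * e) := by
  simp only [star_add, star_smul, add_mul, mul_add, map_add, smul_mul_assoc, mul_smul_comm,
    map_smul, smul_eq_mul]
  ring

/-- Polarisation: the values at 1 + e and 1 + ie are real, which compares the imaginary and the real
parts respectively. -/
theorem positive_star (hφ : ∀ a, 0 ≤ φ (star a * a)) (e : A) : φ (star e) = star (φ e) := by
  have him : ∀ a, (φ (star a * a)).im = 0 := fun a => ((Complex.le_def.1 (hφ a)).2).symm
  have h1 := congrArg Complex.im (positive_expand (φ := φ) 1 e 1)
  have h2 := congrArg Complex.im (positive_expand (φ := φ) 1 e Complex.I)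
  have h0 := him 1
  simp only [star_one, mul_one] at h0
  simp only [him, star_one, one_mul, mul_one, Complex.add_im, Complex.mul_im, Complex.I_re,
    Complex.I_im, RCLike.star_def, Complex.conj_I, Complex.neg_im, h0,
    neg_mul, Complex.I_mul_I, neg_neg] at h1 h2
  apply Complex.ext <;> simp <;> linarith

/-- The degenerate case of Cauchy–Schwarz: with no quadratic term, positivity bounds a nonconstant
affine function of s below, which is impossible. -/
theorem positive_mul_eq_zero (hφ : ∀ a, 0 ≤ φ (star a * a)) {e : A}
    (he : φ (star e * e) = 0) (b : A) : φ (b * e) = 0 := by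
  have hs : φ (star e * star b) = star (φ (b * e)) := by
    rw [← positive_star hφ, star_mul]
  by_contra hne
  set w := φ (b * e) with hw
  have hpos : 0 < Complex.normSq w := Complex.normSq_pos.2 hne
  have key : ∀ s : ℝ, 0 ≤ (φ (star (star b) * star b)).re - 2 * s * Complex.normSq w := by
    intro s
    have h := (Complex.le_def.1 (hφ (star b + (-(s : ℂ) * star w) • e))).1
    rw [positive_expand, he, star_star, ← hw, hs] at h
    have e1 : φ (b * star b) + -(s : ℂ) * star w * w + star (-(s : ℂ) * star w) * star w +
        star (-(s : ℂ) * star w) * (-(s : ℂ) * star w) * 0 =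
        φ (b * star b) - ((2 * s * Complex.normSq w : ℝ) : ℂ) := by
      have : star w * w = (Complex.normSq w : ℂ) := by
        rw [Complex.normSq_eq_conj_mul_self]; rfl
      rw [mul_zero, add_zero, star_mul, star_star, star_neg,
        show star (s : ℂ) = (s : ℂ) from Complex.conj_ofReal s]
      push_cast
      linear_combination (-2 * (s : ℂ)) * this
    rw [e1, Complex.sub_re, Complex.ofReal_re, Complex.zero_re] at h
    rw [star_star]
    exact h
  -- This s makes the right-hand side of `key` equal to -1.
  have := key (((φ (star (star b) * star b)).re + 1) / (2 * Complex.normSq w))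
  rw [show 2 * (((φ (star (star b) * star b)).re + 1) / (2 * Complex.normSq w)) *
    Complex.normSq w = (φ (star (star b) * star b)).re + 1 by field_simp] at this
  linarith

/-- 1 - LL* is a projection, and traciality gives it the value φ(1) - φ(L*L) = 0. -/
theorem tracial_mul_isometry (hφ : ∀ a, 0 ≤ φ (star a * a))
    (htr : ∀ a b, φ (a * b) = φ (b * a)) {L : A} (hL : star L * L = 1) (b : A) :
    φ (b * (L * star L)) = φ b := by
  have hs : star (1 - L * star L) = 1 - L * star L := by
    rw [star_sub, star_mul, star_star, star_one]
  have hi : L * star L * (L * star L) = L * star L := by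
    rw [mul_assoc, ← mul_assoc (star L), hL, one_mul]
  have h0 : φ (star (1 - L * star L) * (1 - L * star L)) = 0 := by
    rw [hs, mul_sub, mul_one, sub_mul, one_mul, hi, sub_self, sub_zero, map_sub, htr, hL,
      sub_self]
  have := positive_mul_eq_zero hφ h0 b
  rw [mul_sub, mul_one, map_sub, sub_eq_zero] at this
  exact this.symm

end Positive

/-! ### Traces and linear sections -/

section Section

variable {A T : Type*} [NormedRing A] [NormedAlgebra ℂ A] [NormedRing T] [NormedAlgebra ℂ T]
  {s : A →L[ℂ] T} {φ : T →L[ℂ] ℂ}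

theorem tracial_section_mul {S : Set A} (hS : ∀ b, b ∈ closure (Submodule.span ℂ S : Set A))
    (h : ∀ b ∈ S, ∀ a d, φ (d * s (a * b)) = φ (d * (s a * s b))) (d : T) (a b : A) :
    φ (d * s (a * b)) = φ (d * (s a * s b)) := by
  have hcl : IsClosed {b : A | φ (d * s (a * b)) = φ (d * (s a * s b))} :=
    isClosed_eq (φ.continuous.comp ((s.continuous.comp (continuous_const_mul a)).const_mul d))
      (φ.continuous.comp ((s.continuous.const_mul (s a)).const_mul d))
  refine closure_minimal (fun b hb => ?_) hcl (hS b)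
  change φ (d * s (a * b)) = φ (d * (s a * s b))
  induction hb using Submodule.span_induction with
  | mem b hb => exact h b hb a d
  | zero => simp only [mul_zero, map_zero]
  | add b c _ _ hb hc =>
    rw [mul_add, ContinuousLinearMap.map_add, ContinuousLinearMap.map_add, mul_add, mul_add,
      mul_add, ContinuousLinearMap.map_add, ContinuousLinearMap.map_add, hb, hc]
  | smul κ b _ hb =>
    rw [mul_smul_comm, ContinuousLinearMap.map_smul, ContinuousLinearMap.map_smul, mul_smul_comm,
      mul_smul_comm, mul_smul_comm, ContinuousLinearMap.map_smul, ContinuousLinearMap.map_smul, hb]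

variable [StarRing T] [StarModule ℂ T]

/-- The elements s(a)s(v) and s(av) agree after right multiplication by L, and a positive trace
allows LL* to be inserted on the right. Later L = L_q, M = L_p and u, v, w are λ_q, λ_{p-q}, λ_p. -/
theorem tracial_section_mul_of_isometry (hφ : ∀ a, 0 ≤ φ (star a * a))
    (htr : ∀ a b, φ (a * b) = φ (b * a)) {L M : T} {u v w : A} {κ : ℂ} (hLL : star L * L = 1)
    (hL : ∀ a, s a * L = s (a * u)) (hM : ∀ a, s a * M = s (a * w)) (hw : s w = M)
    (hvu : v * u = κ • w) (a : A) (d : T) : φ (d * s (a * v)) = φ (d * (s a * s v)) := by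
  have h : s a * s v * L = s (a * v) * L := by
    rw [mul_assoc, hL, hL, mul_assoc, hvu, map_smul, mul_smul_comm, mul_smul_comm, map_smul, hw,
      hM]
  rw [← tracial_mul_isometry hφ htr hLL (d * s (a * v)),
    ← tracial_mul_isometry hφ htr hLL (d * (s a * s v))]
  congr 1
  rw [mul_assoc d, mul_assoc d, ← mul_assoc (s (a * v)), ← h, ← mul_assoc (s a * s v)]

/-- A positive trace for which the section `s` of `q` is multiplicative factors through `q`. -/
theorem tracial_section_quot [StarRing A] (hφ : ∀ a, 0 ≤ φ (star a * a))
    (htr : ∀ a b, φ (a * b) = φ (b * a)) {q : T →⋆ₐ[ℂ] A} (hq : Continuous q) (hs1 : s 1 = 1)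
    (hstar : ∀ a, s (star a) = star (s a))
    (hmul : ∀ d a b, φ (d * s (a * b)) = φ (d * (s a * s b))) {G : Set T}
    (hG : ∀ p : T → Prop, IsClosed {c | p c} → (∀ g ∈ G, p g) → (∀ κ : ℂ, p (algebraMap ℂ T κ)) →
      (∀ a b, p a → p b → p (a + b)) → (∀ a b, p a → p b → p (a * b)) →
      (∀ a, p a → p (star a)) → ∀ c, p c)
    (hgen : ∀ g ∈ G, s (q g) = g) (c d : T) : φ (d * s (q c)) = φ (d * c) := by
  refine hG (fun c => ∀ d, φ (d * s (q c)) = φ (d * c)) ?_ (fun g hg d => ?_) (fun κ d => ?_)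
    (fun a b ha hb d => ?_) (fun a b ha hb d => ?_) (fun a ha d => ?_) c d
  · rw [ofPred_forall]
    exact isClosed_iInter fun d => isClosed_eq
      (φ.continuous.comp ((s.continuous.comp hq).const_mul d))
      (φ.continuous.comp (continuous_const_mul d))
  · rw [hgen g hg]
  · rw [Algebra.algebraMap_eq_smul_one, map_smul, map_one, map_smul, hs1]
  · rw [map_add q, ContinuousLinearMap.map_add, mul_add, ContinuousLinearMap.map_add, mul_add,
      ContinuousLinearMap.map_add, ha d, hb d]
  -- Cyclicity places each factor in turn at the right end, where the hypothesis, valid for all left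
  -- factors, replaces s(q(·)) by the element itself.
  · calc φ (d * s (q (a * b)))
        = φ (d * (s (q a) * s (q b))) := by rw [map_mul q, hmul]
      _ = φ (s (q b) * d * s (q a)) := by rw [← mul_assoc, htr, mul_assoc]
      _ = φ (s (q b) * d * a) := ha _
      _ = φ (d * a * s (q b)) := by rw [mul_assoc, htr]
      _ = φ (d * a * b) := hb _
      _ = φ (d * (a * b)) := by rw [mul_assoc]
  · have h := congrArg star (ha (star d))
    rw [← positive_star hφ, ← positive_star hφ, star_mul, star_mul, star_star, ← hstar,
      ← map_star] at h
    rw [htr, h, htr]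

end Section

/-! ### Weak* homeomorphisms given by pullbacks. -/

section Homeo

variable {A B T : Type*} [NormedRing A] [NormedAlgebra ℂ A] [NormedRing B] [NormedAlgebra ℂ B]
  [NormedRing T] [NormedAlgebra ℂ T]

/-- An element of the weak* dual given by a continuous functional. -/
def toWeak (f : B →L[ℂ] ℂ) : WeakDual ℂ B := StrongDual.toWeakDual f

/-- The continuous functional underlying an element of the weak* dual. -/
def ofWeak (φ : WeakDual ℂ B) : B →L[ℂ] ℂ := WeakDual.toStrongDual φ

/-- Pullback of functionals along a pair of maps as an affine homeomorphism. -/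
theorem exists_affine_homeomorph {S : Set (WeakDual ℂ B)} {K : Set (WeakDual ℂ T)}
    {f : T →L[ℂ] B} {g : B →L[ℂ] T} (hfg : ∀ b, f (g b) = b)
    (h1 : ∀ ω ∈ S, toWeak ((ofWeak ω).comp f) ∈ K)
    (h2 : ∀ φ ∈ K, toWeak ((ofWeak φ).comp g) ∈ S)
    (h3 : ∀ φ ∈ K, ∀ c, φ (g (f c)) = φ c) :
    ∃ h : S ≃ₜ K, IsAffineMap h ∧
      ∀ (ω : S) (c : T), (h ω : WeakDual ℂ T) c = (ω : WeakDual ℂ B) (f c) := by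
  refine ⟨{ toFun := fun ω => ⟨_, h1 ω.1 ω.2⟩
            invFun := fun φ => ⟨_, h2 φ.1 φ.2⟩
            left_inv := fun ω => Subtype.ext (ContinuousLinearMap.ext fun b => ?_)
            right_inv := fun φ => Subtype.ext (ContinuousLinearMap.ext fun c => ?_)
            continuous_toFun := ?_
            continuous_invFun := ?_ }, ?_, fun ω c => rfl⟩
  · exact congrArg (ω.1 : B → ℂ) (hfg b)
  · exact h3 φ.1 φ.2 c
  · refine Continuous.subtype_mk (WeakDual.continuous_of_continuous_eval fun c => ?_) _
    exact (WeakDual.eval_continuous (f c)).comp continuous_subtype_val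
  · refine Continuous.subtype_mk (WeakDual.continuous_of_continuous_eval fun b => ?_) _
    exact (WeakDual.eval_continuous (g b)).comp continuous_subtype_val
  · intro φ ψ χ s _ _ h
    refine ContinuousLinearMap.ext fun c => ?_
    exact congrArg (fun ω : WeakDual ℂ B => ω (f c)) h

end Homeo

variable {n : ℕ} {Θ : Matrix (Fin n) (Fin n) ℝ} {r : Fin n → ℝ} {φ : ToeplitzTorus Θ →L[ℂ] ℂ}

/-! ### Tracial states of the Toeplitz noncommutative torus -/

theorem star_isom_mul_self (p : natCone n) : star (isom Θ p) * isom Θ p = 1 :=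
  Subtype.ext (star_leftReg_mul_self p)

theorem tracial_toepl_mul (hΘ : Θᵀ = -Θ) (hφ : ∀ a, 0 ≤ φ (star a * a))
    (htr : ∀ a b, φ (a * b) = φ (b * a)) (d : ToeplitzTorus Θ) (a b : NCTorus Θ) :
    φ (d * toepl hΘ (a * b)) = φ (d * (toepl hΘ a * toepl hΘ b)) := by
  refine tracial_section_mul (dense_span_lam hΘ) ?_ d a b
  rintro _ ⟨y, rfl⟩ a d
  obtain ⟨p, q, hy, -⟩ := exists_natCone_sub y
  have h1 : lam Θ y * lam Θ q = (cocycle Θ y q : ℂ) • lam Θ p := by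
    rw [lam_mul, hy, sub_add_cancel]
  exact tracial_section_mul_of_isometry hφ htr (star_isom_mul_self q)
    (fun a => toepl_mul_isom hΘ a q) (fun a => toepl_mul_isom hΘ a p) (toepl_lam hΘ p) h1 a d

/-- A positive trace on the Toeplitz noncommutative torus factors through the quotient map. -/
theorem tracial_toepl_quot (hΘ : Θᵀ = -Θ) (hφ : ∀ a, 0 ≤ φ (star a * a))
    (htr : ∀ a b, φ (a * b) = φ (b * a)) (c d : ToeplitzTorus Θ) :
    φ (d * toepl hΘ (quot hΘ c)) = φ (d * c) := by
  refine tracial_section_quot hφ htr (continuous_quot hΘ) (toepl_one hΘ) (toepl_star hΘ)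
    (tracial_toepl_mul hΘ hφ htr) (G := range (isom Θ))
    (fun p h1 h2 h3 h4 h5 h6 => redAlg_induction h1 (fun q => h2 _ ⟨q, rfl⟩) h3 h4 h5 h6) ?_ c d
  rintro _ ⟨p, rfl⟩
  rw [quot_isom, toepl_lam]

theorem isHomog_toepl_lam (hΘ : Θᵀ = -Θ) (x : Fin n → ℤ) : IsHomog (toepl hΘ (lam Θ x)) x := by
  obtain ⟨p, q, rfl, -⟩ := exists_natCone_sub x
  have h : IsHomog (star (isom Θ q) * isom Θ p) ((p : Fin n → ℤ) - q) := by
    rw [← neg_add_eq_sub]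
    exact (isHomog_gen q).star.mul (isHomog_gen p)
  intro z
  rw [toepl_lam_sub, map_smul, h z, smul_comm]

/-- The pullback along the compression of an invariant positive trace is supported on `H_n^r`. -/
theorem tracial_toepl_lam_of_notMem (hΘ : Θᵀ = -Θ) (hφ : ∀ a, 0 ≤ φ (star a * a))
    (htr : ∀ a b, φ (a * b) = φ (b * a))
    (hinv : ∀ t a, φ (dynamics Θ (natCone n) r t a) = φ a) {x : Fin n → ℤ}
    (hx : x ∉ degGroup Θ r) : φ (toepl hΘ (lam Θ x)) = 0 := by
  have hmul : ∀ a b, φ (toepl hΘ (a * b)) = φ (toepl hΘ a * toepl hΘ b) := fun a b => by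
    have := tracial_toepl_mul hΘ hφ htr 1 a b
    rwa [one_mul, one_mul] at this
  obtain ⟨w, hw, h⟩ : ∃ w, monomial w x ≠ 1 ∧
      (monomial w x : ℂ) * φ (toepl hΘ (lam Θ x)) = φ (toepl hΘ (lam Θ x)) := by
    -- An inner character is absorbed by traciality, a dynamical one by α-invariance.
    rcases exists_monomial_ne_one hΘ hx with ⟨v, hv⟩ | ⟨t, ht⟩
    · refine ⟨_, hv, ?_⟩
      have h1 := lam_conj hΘ v (lam Θ x)
      rw [isHomog_lam] at h1
      have h2 := congrArg (fun a => φ (toepl hΘ a)) h1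
      simp only [map_smul, smul_eq_mul] at h2
      rw [← h2, hmul, htr, ← hmul, ← mul_assoc, star_lam_mul_self, one_mul]
    · refine ⟨_, ht, ?_⟩
      have h1 := hinv t (toepl hΘ (lam Θ x))
      rw [dynamics_eq_gauge, isHomog_toepl_lam, map_smul] at h1
      exact h1
  by_contra h0
  exact hw (Circle.coe_eq_one.1 (mul_right_cancel₀ h0 (by rw [h, one_mul])))

end

section

variable {n : ℕ} {Θ : Matrix (Fin n) (Fin n) ℝ} {r : Fin n → ℝ}

/-! ### `KMS_0` states and states of the fixed point algebra -/

/-- The quotient map as a continuous linear map. -/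
def quotL (hΘ : Θᵀ = -Θ) : ToeplitzTorus Θ →L[ℂ] NCTorus Θ where
  toFun := quot hΘ
  map_add' := map_add (quot hΘ)
  map_smul' := map_smul (quot hΘ)
  cont := continuous_quot hΘ

/-- The inclusion of the fixed point algebra as a continuous linear map. -/
def fixedIncl (Θ : Matrix (Fin n) (Fin n) ℝ) (r : Fin n → ℝ) : fixedAlg Θ r →L[ℂ] NCTorus Θ where
  toFun := Subtype.val
  map_add' _ _ := rfl
  map_smul' _ _ := rfl
  cont := continuous_subtype_val

theorem condExp_one : condExp Θ r 1 = 1 := condExp_of_mem (one_mem (fixedAlg Θ r))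

theorem quotL_gauge (hΘ : Θᵀ = -Θ) (τ : NCTorus Θ →L[ℂ] ℂ)
    (hτ : ∀ w ∈ annihilator Θ r, ∀ a, τ (gauge Θ ⊤ w a) = τ a) (t : ℝ) (c : ToeplitzTorus Θ) :
    τ (quot hΘ (dynamics Θ (natCone n) r t c)) = τ (quot hΘ c) :=
  (congrArg τ (quot_gauge hΘ (dynChar r t) c)).trans (hτ _ (dynChar_mem Θ r t) _)

theorem tracial_state_comp {A T : Type*} [NormedRing A] [StarRing A] [NormedAlgebra ℂ A]
    [NormedRing T] [StarRing T] [NormedAlgebra ℂ T] (q : T →⋆ₐ[ℂ] A) (f : T →L[ℂ] A)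
    (hf : ∀ c, f c = q c) {τ : A →L[ℂ] ℂ} (hpos : ∀ a, 0 ≤ τ (star a * a))
    (htr : ∀ a b, τ (a * b) = τ (b * a)) (h1 : τ 1 = 1) :
    toWeak (τ.comp f) ∈ stateSpace T ∧
      ∀ c d, toWeak (τ.comp f) (c * d) = toWeak (τ.comp f) (d * c) := by
  have h : ∀ c, toWeak (τ.comp f) c = τ (q c) := fun c => congrArg τ (hf c)
  refine ⟨⟨?_, fun c => ?_⟩, fun c d => ?_⟩
  · rw [h, map_one, h1]
  · rw [h, map_mul q, map_star q]
    exact hpos _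
  · rw [h, h, map_mul q, map_mul q]
    exact htr _ _

theorem comp_quotL_mem_kmsZeroStates (hΘ : Θᵀ = -Θ) {τ : NCTorus Θ →L[ℂ] ℂ}
    (hτ : ∀ x, x ∉ degGroup Θ r → τ (lam Θ x) = 0) (hpos : ∀ a, 0 ≤ τ (star a * a))
    (h1 : τ 1 = 1) : toWeak (τ.comp (quotL hΘ)) ∈ kmsZeroStates Θ r := by
  have h := tracial_state_comp (quot hΘ) (quotL hΘ) (fun _ => rfl) hpos
    (functional_mul_comm hΘ hτ) h1
  exact ⟨h.1, h.2, quotL_gauge hΘ τ fun w hw a => functional_gauge hΘ hτ hw a⟩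

theorem pullback_mem_kmsZeroStates (hΘ : Θᵀ = -Θ) {ω : WeakDual ℂ (fixedAlg Θ r)}
    (hω : ω ∈ stateSpace (fixedAlg Θ r)) :
    toWeak ((ofWeak ω).comp ((condExp Θ r).comp (quotL hΘ))) ∈ kmsZeroStates Θ r := by
  have hτ : ∀ x, x ∉ degGroup Θ r → ((ofWeak ω).comp (condExp Θ r)) (lam Θ x) = 0 := fun x hx =>
    (congrArg (ofWeak ω) (condExp_lam_of_notMem hΘ hx)).trans (map_zero (ofWeak ω))
  refine comp_quotL_mem_kmsZeroStates (τ := (ofWeak ω).comp (condExp Θ r)) hΘ hτ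
    (functional_nonneg hΘ hτ fun a ha => ?_) ?_
  · have h := congrArg (ofWeak ω) (condExp_of_mem (mul_mem (star_mem ha) ha))
    exact (hω.2 ⟨a, ha⟩).trans_eq h.symm
  · exact (congrArg (ofWeak ω) condExp_one).trans hω.1

theorem functional_gaugeAverage (hΘ : Θᵀ = -Θ) {τ : NCTorus Θ →L[ℂ] ℂ}
    (hτ : ∀ x, x ∉ degGroup Θ r → τ (lam Θ x) = 0) (a : NCTorus Θ) :
    τ (gaugeAverage Θ r a) = τ a := by
  refine ncTorus_induction hΘ (p := fun a => τ (gaugeAverage Θ r a) = τ a)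
    (isClosed_eq (τ.continuous.comp continuous_gaugeAverage) τ.continuous)
    (fun a b ha hb => ?_) (fun c x => ?_) a
  · rw [gaugeAverage_add, map_add, map_add]
    exact congrArg₂ (· + ·) ha hb
  · rw [gaugeAverage_smul, map_smul, map_smul]
    by_cases hx : x ∈ degGroup Θ r
    · rw [gaugeAverage_of_mem (lam_mem_fixedAlg hx)]
    · rw [gaugeAverage_lam_of_notMem hΘ hx, hτ x hx, map_zero]

theorem positive_section {A T : Type*} [NormedRing A] [StarRing A] [NormedAlgebra ℂ A]
    [NormedRing T] [StarRing T] [NormedAlgebra ℂ T] {s : A →L[ℂ] T} {φ : T →L[ℂ] ℂ}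
    (hφ : ∀ a, 0 ≤ φ (star a * a)) (hstar : ∀ a, s (star a) = star (s a))
    (hmul : ∀ d a b, φ (d * s (a * b)) = φ (d * (s a * s b))) (a : A) :
    0 ≤ φ (s (star a * a)) := by
  have h := hmul 1 (star a) a
  rw [one_mul, one_mul, hstar] at h
  exact (hφ _).trans_eq h.symm

theorem restrict_mem_stateSpace (hΘ : Θᵀ = -Θ) {φ : WeakDual ℂ (ToeplitzTorus Θ)}
    (hφ : φ ∈ kmsZeroStates Θ r) :
    toWeak ((ofWeak φ).comp ((toepl hΘ).comp (fixedIncl Θ r))) ∈ stateSpace (fixedAlg Θ r) := by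
  obtain ⟨⟨h1, hpos⟩, htr, -⟩ := hφ
  refine ⟨(congrArg φ (toepl_one hΘ)).trans h1, fun a => ?_⟩
  exact positive_section (φ := ofWeak φ) hpos (toepl_star hΘ)
    (tracial_toepl_mul (φ := ofWeak φ) hΘ hpos htr) a.1

theorem kmsZero_toepl_condExp_quot (hΘ : Θᵀ = -Θ) {φ : WeakDual ℂ (ToeplitzTorus Θ)}
    (hφ : φ ∈ kmsZeroStates Θ r) (c : ToeplitzTorus Θ) :
    φ (toepl hΘ (gaugeAverage Θ r (quot hΘ c))) = φ c := by
  obtain ⟨⟨h1, hpos⟩, htr, hinv⟩ := hφ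
  have h2 := functional_gaugeAverage (τ := (ofWeak φ).comp (toepl hΘ)) hΘ
    (fun x hx => tracial_toepl_lam_of_notMem (φ := ofWeak φ) hΘ hpos htr hinv hx) (quot hΘ c)
  have h3 := tracial_toepl_quot (φ := ofWeak φ) hΘ hpos htr c 1
  rw [one_mul, one_mul] at h3
  exact h2.trans h3

theorem condExp_quot_toepl (hΘ : Θᵀ = -Θ) (b : fixedAlg Θ r) :
    condExp Θ r (quot hΘ (toepl hΘ b.1)) = b := by
  rw [quot_toepl]
  exact condExp_of_mem b.2

/-- The inverse restricts a trace along `toepl` to the fixed point algebra. Both directions are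
pullbacks, hence weak* continuous. -/
theorem exists_homeomorph_kmsZeroStates (hΘ : Θᵀ = -Θ) (r : Fin n → ℝ) :
    ∃ h : stateSpace (fixedAlg Θ r) ≃ₜ kmsZeroStates Θ r,
      IsAffineMap h ∧
      ∀ (ω : stateSpace (fixedAlg Θ r)) (a : ToeplitzTorus Θ),
        (h ω : WeakDual ℂ (ToeplitzTorus Θ)) a =
          (ω : WeakDual ℂ (fixedAlg Θ r)) (condExpAnn Θ r (quot hΘ a)) :=
  exists_affine_homeomorph (f := (condExp Θ r).comp (quotL hΘ))
    (g := (toepl hΘ).comp (fixedIncl Θ r)) (condExp_quot_toepl hΘ)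
    (fun _ hω => pullback_mem_kmsZeroStates hΘ hω) (fun _ hφ => restrict_mem_stateSpace hΘ hφ)
    (fun _ hφ c => kmsZero_toepl_condExp_quot hΘ hφ c)

end

section

variable {n : ℕ} {Θ : Matrix (Fin n) (Fin n) ℝ} {r : Fin n → ℝ}

/-! ### `KMS_{0⁺}` states -/

/-- In this form the orbit visibly extends to an entire function of t, with value e^{-⟨x,r⟩β} a at
iβ. -/
theorem IsHomog.dynamics {P : AddSubmonoid (Fin n → ℤ)} {a : redAlg Θ P} {x : Fin n → ℤ}
    (ha : IsHomog a x) (r : Fin n → ℝ) (t : ℝ) : dynamics Θ P r t a =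
      Complex.exp (Complex.I * (∑ j, (x j : ℝ) * r j : ℝ) * t) • a := by
  rw [dynamics_eq_gauge, ha, monomial_dynChar, Circle.coe_exp]
  congr 2
  push_cast
  ring

theorem exists_analytic_extension {A : Type*} [NormedRing A] [NormedAlgebra ℂ A] (a : A)
    (s : ℝ) : Differentiable ℂ fun z : ℂ => Complex.exp (Complex.I * s * z) • a := by
  have : Differentiable ℂ fun z : ℂ => Complex.exp (Complex.I * s * z) := by fun_prop
  exact this.smul_const a

/-- The KMS condition on homogeneous elements. -/
theorem kmsStates_mul_comm {β : ℝ} {ψ : WeakDual ℂ (ToeplitzTorus Θ)} (hψ : ψ ∈ kmsStates Θ r β)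
    {a : ToeplitzTorus Θ} {x : Fin n → ℤ} (ha : IsHomog a x) (b : ToeplitzTorus Θ) :
    ψ (a * b) = (Real.exp (-((∑ j, (x j : ℝ) * r j) * β)) : ℂ) * ψ (b * a) := by
  have h := hψ.2 a b _ (exists_analytic_extension a (∑ j, (x j : ℝ) * r j))
    fun t => (ha.dynamics r t).symm
  rw [h, mul_smul_comm, map_smul, smul_eq_mul]
  congr 1
  rw [Complex.ofReal_exp]
  congr 1
  push_cast
  linear_combination ((∑ j, (x j : ℂ) * (r j : ℂ)) * β) * Complex.I_mul_I

theorem kmsZeroPlus_mul_comm_of_isHomog {φ : WeakDual ℂ (ToeplitzTorus Θ)}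
    (hφ : φ ∈ kmsZeroPlusStates Θ r) {a : ToeplitzTorus Θ} {x : Fin n → ℤ} (ha : IsHomog a x)
    (b : ToeplitzTorus Θ) : φ (a * b) = φ (b * a) := by
  obtain ⟨ι, l, β, ψ, hl, hβ, hψ, hlim⟩ := hφ
  have hev : ∀ c, Tendsto (fun i => ψ i c) l (𝓝 (φ c)) := fun c =>
    ((WeakDual.eval_continuous c).tendsto φ).comp hlim
  have hβ0 : Tendsto β l (𝓝 0) := hβ.mono_right nhdsWithin_le_nhds
  have hexp : Tendsto (fun i => (Real.exp (-((∑ j, (x j : ℝ) * r j) * β i)) : ℂ)) l (𝓝 1) := by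
    have h : Continuous fun y : ℝ => (Real.exp (-((∑ j, (x j : ℝ) * r j) * y)) : ℂ) := by
      fun_prop
    have e : (Real.exp (-((∑ j, (x j : ℝ) * r j) * 0)) : ℂ) = 1 := by simp
    rw [← e]
    exact (h.tendsto 0).comp hβ0
  have h2 := hexp.mul (hev (b * a))
  rw [one_mul] at h2
  refine tendsto_nhds_unique (hev (a * b)) (h2.congr fun i => ?_)
  exact (kmsStates_mul_comm (hψ i) ha b).symm

theorem kmsZeroPlus_apply_eq_zero {φ : WeakDual ℂ (ToeplitzTorus Θ)}
    (hφ : φ ∈ kmsZeroPlusStates Θ r) {c : ToeplitzTorus Θ}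
    (hc : ∀ β > 0, ∀ ψ ∈ kmsStates Θ r β, ψ c = 0) : φ c = 0 := by
  obtain ⟨ι, l, β, ψ, hl, hβ, hψ, hlim⟩ := hφ
  have hev : Tendsto (fun i => ψ i c) l (𝓝 (φ c)) :=
    ((WeakDual.eval_continuous c).tendsto φ).comp hlim
  refine tendsto_nhds_unique hev (tendsto_const_nhds.congr' ?_)
  filter_upwards [hβ.eventually self_mem_nhdsWithin] with i hi
  exact (hc _ hi _ (hψ i)).symm

theorem kmsZeroPlus_mem_stateSpace {φ : WeakDual ℂ (ToeplitzTorus Θ)}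
    (hφ : φ ∈ kmsZeroPlusStates Θ r) : φ ∈ stateSpace (ToeplitzTorus Θ) := by
  obtain ⟨ι, l, β, ψ, hl, hβ, hψ, hlim⟩ := hφ
  have hev : ∀ c, Tendsto (fun i => ψ i c) l (𝓝 (φ c)) := fun c =>
    ((WeakDual.eval_continuous c).tendsto φ).comp hlim
  refine ⟨tendsto_nhds_unique (hev 1) (tendsto_const_nhds.congr fun i => (hψ i).1.1.symm),
    fun a => ge_of_tendsto (hev _) (Eventually.of_forall fun i => (hψ i).1.2 a)⟩

/-- If ⟨x,r⟩ ≠ 0, the KMS_β condition against 1 reads ψ(a) = e^{-⟨x,r⟩β} ψ(a), so every ψ with β > 0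
vanishes on a, and so does the limit. -/
theorem kmsZeroPlus_dynamics_of_isHomog {φ : WeakDual ℂ (ToeplitzTorus Θ)}
    (hφ : φ ∈ kmsZeroPlusStates Θ r) {a : ToeplitzTorus Θ} {x : Fin n → ℤ} (ha : IsHomog a x)
    (t : ℝ) : φ (dynamics Θ (natCone n) r t a) = φ a := by
  rw [ha.dynamics, map_smul]
  by_cases hs : ∑ j, (x j : ℝ) * r j = 0
  · simp [hs]
  · have h0 : φ a = 0 := by
      refine kmsZeroPlus_apply_eq_zero hφ fun β hβ ψ hψ => ?_
      have h := kmsStates_mul_comm hψ ha 1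
      rw [mul_one, one_mul] at h
      by_contra hne
      have h1 : (Real.exp (-((∑ j, (x j : ℝ) * r j) * β)) : ℂ) = 1 :=
        mul_right_cancel₀ hne (by rw [← h, one_mul])
      have h2 : Real.exp (-((∑ j, (x j : ℝ) * r j) * β)) = 1 := by exact_mod_cast h1
      rw [Real.exp_eq_one_iff, neg_eq_zero] at h2
      exact (mul_ne_zero hs hβ.ne') h2
    rw [h0, smul_zero]

theorem kmsZeroPlusStates_subset (Θ : Matrix (Fin n) (Fin n) ℝ) (r : Fin n → ℝ) :
    kmsZeroPlusStates Θ r ⊆ kmsZeroStates Θ r := by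
  intro φ hφ
  have hc : Continuous φ := (ofWeak φ).continuous
  refine ⟨kmsZeroPlus_mem_stateSpace hφ, fun a b => ?_, fun t a => ?_⟩
  · refine redAlg_induction_homog (p := fun a => φ (a * b) = φ (b * a))
      (isClosed_eq (hc.comp (continuous_id.mul continuous_const))
        (hc.comp (continuous_const.mul continuous_id))) (fun a c ha hc => ?_)
      (fun a x ha => kmsZeroPlus_mul_comm_of_isHomog hφ ha b) a
    rw [add_mul, mul_add, map_add, map_add]
    exact congrArg₂ (· + ·) ha hc
  · refine redAlg_induction_homog (p := fun a => φ (dynamics Θ (natCone n) r t a) = φ a)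
      (isClosed_eq (hc.comp (continuous_gauge _)) hc) (fun a c ha hc => ?_)
      (fun a x ha => kmsZeroPlus_dynamics_of_isHomog hφ ha t) a
    rw [map_add, map_add, map_add]
    exact congrArg₂ (· + ·) ha hc

/-! ### Commutation for disjoint supports and vanishing of KMS_β states. -/

theorem inner_delta_delta_of_ne {P : AddSubmonoid (Fin n → ℤ)} {p q : P} (h : p ≠ q) :
    inner ℂ (delta P p) (delta P q) = 0 := by
  rw [inner_delta, delta_apply_of_ne h]

theorem star_leftReg_delta_of_notMem {P : AddSubmonoid (Fin n → ℤ)} (p q : P)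
    (h : ∀ u : P, p + u ≠ q) : star (leftReg Θ P p) (delta P q) = 0 := by
  ext u
  rw [← inner_delta, ContinuousLinearMap.star_eq_adjoint,
    ContinuousLinearMap.adjoint_inner_right, leftReg_delta, inner_smul_left,
    inner_delta_delta_of_ne (h u), mul_zero]
  rfl

theorem star_leftReg_mul_leftReg_of_disjoint (p q : natCone n)
    (hpq : ∀ j, (p : Fin n → ℤ) j = 0 ∨ (q : Fin n → ℤ) j = 0) :
    star (leftReg Θ (natCone n) q) * leftReg Θ (natCone n) p =
      ((cocycle Θ p q * (cocycle Θ q p)⁻¹ : Circle) : ℂ) •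
        (leftReg Θ (natCone n) p * star (leftReg Θ (natCone n) q)) := by
  apply ext_delta
  intro u
  rw [smul_apply, mul_apply_eq_comp, mul_apply_eq_comp, leftReg_delta, map_smul]
  by_cases hu : ∃ t : natCone n, q + t = u
  · obtain ⟨t, rfl⟩ := hu
    rw [show p + (q + t) = q + (p + t) by abel, star_leftReg_delta_add, star_leftReg_delta_add,
      Circle.smul_def, Circle.smul_def, map_smul, leftReg_delta, smul_smul, smul_smul, smul_smul]
    congr 1
    simp only [AddSubmonoid.coe_add, cocycle_add_right, Circle.coe_mul, mul_inv, Circle.coe_inv]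
    ring
  · rw [star_leftReg_delta_of_notMem q u fun t ht => hu ⟨t, ht⟩, map_zero, smul_zero,
      star_leftReg_delta_of_notMem q (p + u), smul_zero]
    intro t ht
    apply hu
    -- Where q is nonzero p is zero, so q ≤ p + u already implies q ≤ u.
    have h : ∀ j, (q : Fin n → ℤ) j + (t : Fin n → ℤ) j = (p : Fin n → ℤ) j + (u : Fin n → ℤ) j :=
      fun j => congrFun (congrArg Subtype.val ht) j
    refine ⟨⟨fun j => (u : Fin n → ℤ) j - (q : Fin n → ℤ) j, fun j => ?_⟩, Subtype.ext ?_⟩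
    · have h1 := h j
      have h2 : 0 ≤ (t : Fin n → ℤ) j := t.2 j
      have h3 : 0 ≤ (u : Fin n → ℤ) j := u.2 j
      rcases hpq j with h4 | h4 <;> simp only <;> omega
    · ext j
      simp

/-- Moving L_p around costs e^{-⟨p,r⟩β} < 1, while commuting it back past L_q* costs only a phase;
the value equals a strict contraction of itself. -/
theorem kmsStates_isom_mul_star_isom {β : ℝ} (hβ : 0 < β) {ψ : WeakDual ℂ (ToeplitzTorus Θ)}
    (hψ : ψ ∈ kmsStates Θ r β) (p q : natCone n)
    (hpq : ∀ j, (p : Fin n → ℤ) j = 0 ∨ (q : Fin n → ℤ) j = 0)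
    (hp : 0 < ∑ j, ((p : Fin n → ℤ) j : ℝ) * r j) : ψ (isom Θ p * star (isom Θ q)) = 0 := by
  have h1 := kmsStates_mul_comm hψ (isHomog_gen p) (star (isom Θ q))
  have h2 : star (isom Θ q) * isom Θ p = ((cocycle Θ p q * (cocycle Θ q p)⁻¹ : Circle) : ℂ) •
      (isom Θ p * star (isom Θ q)) :=
    Subtype.ext (star_leftReg_mul_leftReg_of_disjoint p q hpq)
  have h3 : ψ (isom Θ p * star (isom Θ q)) =
      (Real.exp (-((∑ j, ((p : Fin n → ℤ) j : ℝ) * r j) * β)) : ℂ) *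
        (((cocycle Θ p q * (cocycle Θ q p)⁻¹ : Circle) : ℂ) *
          ψ (isom Θ p * star (isom Θ q))) := by
    refine h1.trans ?_
    change _ * ψ (star (isom Θ q) * isom Θ p) = _
    rw [h2, map_smul, smul_eq_mul]
  have h4 := congrArg norm h3
  rw [norm_mul, norm_mul, Circle.norm_coe, one_mul, Complex.norm_real, Real.norm_eq_abs,
    Real.abs_exp] at h4
  have h5 : Real.exp (-((∑ j, ((p : Fin n → ℤ) j : ℝ) * r j) * β)) < 1 :=
    Real.exp_lt_one_iff.2 (neg_lt_zero.2 (mul_pos hp hβ))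
  have h6 : ‖ψ (isom Θ p * star (isom Θ q))‖ = 0 := by
    have := norm_nonneg (ψ (isom Θ p * star (isom Θ q)))
    nlinarith
  exact norm_eq_zero.1 h6

/-! ### A state of the fixed point algebra not vanishing on `λ_w` -/

/-- The functional `a ↦ ⟨ξ, a ξ⟩`. -/
def vectorFunctional (Θ : Matrix (Fin n) (Fin n) ℝ) (ξ : Ell2 (fullCone n)) :
    NCTorus Θ →L[ℂ] ℂ :=
  LinearMap.mkContinuous
    { toFun := fun a => inner ℂ ξ (a.1 ξ)
      map_add' := fun a b => inner_add_right _ _ _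
      map_smul' := fun c a => inner_smul_right _ _ _ }
    (‖ξ‖ * ‖ξ‖) fun a => by
      refine (norm_inner_le_norm (𝕜 := ℂ) ξ _).trans ?_
      rw [mul_assoc, mul_comm ‖ξ‖ ‖a‖]
      exact mul_le_mul_of_nonneg_left (a.1.le_opNorm ξ) (norm_nonneg _)

theorem vectorFunctional_apply (ξ : Ell2 (fullCone n)) (a : NCTorus Θ) :
    vectorFunctional Θ ξ a = inner ℂ ξ (a.1 ξ) := rfl

theorem vectorFunctional_nonneg (ξ : Ell2 (fullCone n)) (a : NCTorus Θ) :
    0 ≤ vectorFunctional Θ ξ (star a * a) := by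
  change 0 ≤ inner ℂ ξ (star a.1 (a.1 ξ))
  rw [ContinuousLinearMap.star_eq_adjoint, ContinuousLinearMap.adjoint_inner_right]
  rw [inner_self_eq_norm_sq_to_K]
  have h := Complex.zero_le_real.2 (sq_nonneg ‖a.1 ξ‖)
  rwa [Complex.ofReal_pow] at h

theorem vectorFunctional_one (ξ : Ell2 (fullCone n)) :
    vectorFunctional Θ ξ 1 = (‖ξ‖ : ℂ) ^ 2 := by
  change inner ℂ ξ ξ = _
  exact inner_self_eq_norm_sq_to_K ξ

/-- λ_w sends δ_0 to δ_w, and the other three inner products vanish because 0, w and 2w are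
distinct. -/
theorem vectorFunctional_lam {w : Fin n → ℤ} (hw : w ≠ 0) :
    vectorFunctional Θ (delta (fullCone n) 0 + delta (fullCone n) (toFull w)) (lam Θ w) = 1 := by
  have h1 : w + w ≠ 0 := fun h => hw (by
    ext j
    have := congrFun h j
    simp only [Pi.add_apply, Pi.zero_apply] at this ⊢
    omega)
  have h2 : w + w ≠ w := fun h => hw (by simpa using h)
  have e1 : toFull w + 0 = toFull w := add_zero _
  have n1 : (0 : fullCone n) ≠ toFull w := fun h => hw (congrArg Subtype.val h).symm
  have n2 : (0 : fullCone n) ≠ toFull w + toFull w := fun h => h1 (congrArg Subtype.val h).symm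
  have n3 : toFull w ≠ toFull w + toFull w := fun h => h2 (congrArg Subtype.val h).symm
  rw [vectorFunctional_apply, map_add, lam_delta, lam_delta, e1, inner_add_left, inner_add_right,
    inner_add_right, inner_smul_right, inner_smul_right, inner_smul_right, inner_smul_right,
    inner_delta_delta_of_ne n1, inner_delta_delta_of_ne n2, inner_delta_delta_of_ne n3,
    inner_delta, delta_apply_self]
  simp [cocycle_zero_right]

theorem comp_fixedIncl_mem_stateSpace {τ : NCTorus Θ →L[ℂ] ℂ} (h1 : τ 1 = 1)
    (hpos : ∀ a, 0 ≤ τ (star a * a)) :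
    toWeak (τ.comp (fixedIncl Θ r)) ∈ stateSpace (fixedAlg Θ r) :=
  ⟨h1, fun a => hpos a.1⟩

theorem exists_state_lam_ne_zero (Θ : Matrix (Fin n) (Fin n) ℝ) {w : Fin n → ℤ} (hw0 : w ≠ 0) :
    ∃ τ : NCTorus Θ →L[ℂ] ℂ, τ 1 = 1 ∧ (∀ a, 0 ≤ τ (star a * a)) ∧ τ (lam Θ w) ≠ 0 := by
  set ξ := delta (fullCone n) 0 + delta (fullCone n) (toFull w) with hξ
  have hne : ‖ξ‖ ≠ 0 := by
    intro h
    rw [norm_eq_zero] at h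
    have h1 := vectorFunctional_lam (Θ := Θ) hw0
    rw [← hξ, h, vectorFunctional_apply, inner_zero_left] at h1
    exact zero_ne_one h1
  have hc : (0 : ℂ) ≤ ((‖ξ‖ ^ 2)⁻¹ : ℝ) := by
    rw [Complex.zero_le_real]
    positivity
  have hc0 : (((‖ξ‖ ^ 2)⁻¹ : ℝ) : ℂ) ≠ 0 := by
    rw [Complex.ofReal_ne_zero]
    positivity
  refine ⟨(((‖ξ‖ ^ 2)⁻¹ : ℝ) : ℂ) • vectorFunctional Θ ξ, ?_, fun a => ?_, ?_⟩
  · change (((‖ξ‖ ^ 2)⁻¹ : ℝ) : ℂ) * vectorFunctional Θ ξ 1 = 1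
    rw [vectorFunctional_one]
    push_cast
    exact inv_mul_cancel₀ (pow_ne_zero 2 (Complex.ofReal_ne_zero.2 hne))
  · exact mul_nonneg hc (vectorFunctional_nonneg ξ a)
  · change (((‖ξ‖ ^ 2)⁻¹ : ℝ) : ℂ) * vectorFunctional Θ ξ (lam Θ w) ≠ 0
    rw [vectorFunctional_lam hw0, mul_one]
    exact hc0

theorem quot_isom_mul_star_isom (hΘ : Θᵀ = -Θ) (p q : natCone n) :
    quot hΘ (isom Θ p * star (isom Θ q)) =
      (((cocycle Θ p q)⁻¹ : Circle) : ℂ) • lam Θ ((p : Fin n → ℤ) - q) := by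
  have h := (quot hΘ).map_mul' (isom Θ p) (star (isom Θ q))
  refine h.trans ?_
  change quot hΘ (isom Θ p) * quot hΘ (star (isom Θ q)) = _
  rw [quot_star, quot_isom, quot_isom, star_lam hΘ, lam_mul, cocycle_neg_right, ← sub_eq_add_neg]

theorem functional_lam_eq_zero_of_kmsZeroPlus (hΘ : Θᵀ = -Θ) {τ : NCTorus Θ →L[ℂ] ℂ}
    (hmem : toWeak (τ.comp (quotL hΘ)) ∈ kmsZeroPlusStates Θ r) (p q : natCone n)
    (hpq : ∀ j, (p : Fin n → ℤ) j = 0 ∨ (q : Fin n → ℤ) j = 0)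
    (hp : 0 < ∑ j, ((p : Fin n → ℤ) j : ℝ) * r j) : τ (lam Θ ((p : Fin n → ℤ) - q)) = 0 := by
  have h0 : τ (quot hΘ (isom Θ p * star (isom Θ q))) = 0 :=
    kmsZeroPlus_apply_eq_zero hmem fun β hβ ψ hψ => kmsStates_isom_mul_star_isom hβ hψ p q hpq hp
  rw [quot_isom_mul_star_isom, map_smul, smul_eq_mul] at h0
  exact (mul_eq_zero.1 h0).resolve_left (Circle.coe_ne_zero _)

/-- The witness is the KMS_0 state induced by a vector state that is nonzero on λ_{p-q}; the
conditional expectation fixes λ_{p-q} because p - q lies in H_n^r. -/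
theorem kmsZeroPlusStates_ssubset (hΘ : Θᵀ = -Θ) (p q : natCone n)
    (hw : (p : Fin n → ℤ) - q ∈ degGroup Θ r) (hw0 : (p : Fin n → ℤ) - q ≠ 0)
    (hpq : ∀ j, (p : Fin n → ℤ) j = 0 ∨ (q : Fin n → ℤ) j = 0)
    (hp : 0 < ∑ j, ((p : Fin n → ℤ) j : ℝ) * r j) :
    kmsZeroPlusStates Θ r ⊂ kmsZeroStates Θ r := by
  refine (ssubset_iff_of_subset (kmsZeroPlusStates_subset Θ r)).2 ?_
  obtain ⟨τ, h1, hpos, hne⟩ := exists_state_lam_ne_zero Θ hw0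
  refine ⟨_, pullback_mem_kmsZeroStates hΘ (comp_fixedIncl_mem_stateSpace h1 hpos),
    fun hmem => hne ?_⟩
  have h := functional_lam_eq_zero_of_kmsZeroPlus
    (τ := (τ.comp (fixedIncl Θ r)).comp (condExp Θ r)) hΘ hmem p q hpq hp
  exact (congrArg τ (gaugeAverage_of_mem (lam_mem_fixedAlg hw))).symm.trans h

/-- If `p - q` is orthogonal to `r ≥ 0`, `p` and `q` are disjoint, and `p - q` does not vanish on
the support of `r`, then `⟨p, r⟩ > 0`. -/
theorem sum_mul_pos_of_disjoint (hr : ∀ j, 0 ≤ r j) (p q : natCone n)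
    (hsum : ∑ j, ((((p : Fin n → ℤ) - q) j : ℤ) : ℝ) * r j = 0)
    (hne : ∃ j, 0 < r j ∧ ((p : Fin n → ℤ) - q) j ≠ 0) :
    0 < ∑ j, ((p : Fin n → ℤ) j : ℝ) * r j := by
  have hnonneg : ∀ (p : natCone n) j, j ∈ Finset.univ → 0 ≤ ((p : Fin n → ℤ) j : ℝ) * r j :=
    fun p j _ => mul_nonneg (by exact_mod_cast p.2 j) (hr j)
  -- Were ⟨p,r⟩ = ⟨q,r⟩ zero, each nonnegative term of both sums would vanish, and p and q would
  -- both be zero wherever r is positive.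
  have heq : ∑ j, ((p : Fin n → ℤ) j : ℝ) * r j = ∑ j, ((q : Fin n → ℤ) j : ℝ) * r j := by
    rw [← sub_eq_zero, ← Finset.sum_sub_distrib, ← hsum]
    refine Finset.sum_congr rfl fun j _ => ?_
    rw [Pi.sub_apply]
    push_cast
    ring
  refine (Finset.sum_nonneg (hnonneg p)).lt_of_ne fun h0 => ?_
  obtain ⟨j, hj, hj'⟩ := hne
  have h1 := (Finset.sum_eq_zero_iff_of_nonneg (hnonneg p)).1 h0.symm j (Finset.mem_univ j)
  have h2 := (Finset.sum_eq_zero_iff_of_nonneg (hnonneg q)).1 (heq.symm.trans h0.symm) j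
    (Finset.mem_univ j)
  have h3 := (mul_eq_zero.1 h1).resolve_right hj.ne'
  have h4 := (mul_eq_zero.1 h2).resolve_right hj.ne'
  rw [Int.cast_eq_zero] at h3 h4
  exact hj' (by rw [Pi.sub_apply, h3, h4, sub_zero])

end

end

end ToeplitzTori

open ToeplitzTori in
theorem mainTheorem11 (k d : ℕ) (Θ : Matrix (Fin (k + d)) (Fin (k + d)) ℝ) (hΘ : Θᵀ = -Θ)
    (r : Fin (k + d) → ℝ) (hr_pos : ∀ i : Fin k, 0 < r (Fin.castAdd d i))
    (hr_zero : ∀ j : Fin d, r (Fin.natAdd k j) = 0) :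
    (∀ a : NCTorus Θ, a ∈ fixedAlg Θ r ↔
      a ∈ Set.center (NCTorus Θ) ∧ ∀ t : ℝ, dynamics Θ ⊤ r t a = a) ∧
    (∃ π : ToeplitzTorus Θ →⋆ₐ[ℂ] NCTorus Θ,
      (∀ j, π (isom Θ (stdVec j)) = unitaryGen Θ j) ∧
      ∃ h : stateSpace (fixedAlg Θ r) ≃ₜ kmsZeroStates Θ r,
        IsAffineMap h ∧
        ∀ (ω : stateSpace (fixedAlg Θ r)) (a : ToeplitzTorus Θ),
          (h ω : WeakDual ℂ (ToeplitzTorus Θ)) a =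
            (ω : WeakDual ℂ (fixedAlg Θ r)) (condExpAnn Θ r (π a))) ∧
    ((∃ w ∈ degGroup Θ r, w ≠ 0 ∧ ∀ j : Fin d, w (Fin.natAdd k j) = 0) →
      kmsZeroPlusStates Θ r ⊂ kmsZeroStates Θ r) := by
  refine ⟨mem_fixedAlg_iff hΘ, ⟨quot hΘ, fun j => quot_isom hΘ (stdVec j),
    exists_homeomorph_kmsZeroStates hΘ r⟩, ?_⟩
  rintro ⟨w, hw, hw0, hwd⟩
  obtain ⟨p, q, rfl, hpq⟩ := exists_natCone_sub w
  refine kmsZeroPlusStates_ssubset hΘ p q hw hw0 hpq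
    (sum_mul_pos_of_disjoint (fun j => ?_) p q hw.2 ?_)
  · induction j using Fin.addCases with
    | left i => exact (hr_pos i).le
    | right j => exact (hr_zero j).ge
  -- w vanishes on the last d coordinates, so it must be nonzero at some coordinate where r is
  -- positive.
  · by_contra! h
    refine hw0 (funext fun j => ?_)
    induction j using Fin.addCases with
    | left i => exact h _ (hr_pos i)
    | right j => exact hwd j
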